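/- There are a polynomial $T_0(x,y,z)$ and a constant $\delta>0$ such that the following holds for every finite simple graph $G=(V,E)$ of maximum degree $\Delta\ge 2$ and every finite palette $P$ of at least $4.182(\Delta-1)$ colors. Let $\Omega$ be the set of proper edge-colorings of $G$ with colors from $P$ and without bichromatic 4-cycles (a cycle is bichromatic if its edges receive exactly two colors). For a partial edge-coloring, a color $c$ is 4-available for an edge $e$ if giving $e$ the color $c$ neither makes it agree in color with an edge sharing a vertex with $e$ nor creates a bichromatic 4-cycle containing $e$. Fix arbitrary linear orderings of $E$, of $P$ and of the set of even cycles of length at least 6 of $G$, and for every such cycle $C$ an arbitrary ordered pair $e_1^C,e_2^C$ of adjacent edges of $C$. * Coloring the edges in the given order, each with the greatest color that is 4-available for it at that time, succeeds and gives a coloring $\sigma_1\in\Omega$. * To *address* a cycle $C$ at $\sigma\in\Omega$ (one step) means to replace $\sigma$ by a uniformly random element of $A(C,\sigma)$, the set of all $\tau\in\Omega$ that may result from uncoloring all edges of $C$ other than $e_1^C,e_2^C$ and then going around $C$, starting with the uncolored edge adjacent to $e_2^C$, and giving each uncolored edge one of the colors that are 4-available for it at that time. * The *recursive walk* starts at $\sigma_1$.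 While some even cycle of length at least 6 is bichromatic in the current coloring, it calls Address($C$) for the greatest such cycle $C$. The procedure Address($C$) addresses $C$ and then, while some even cycle of length at least 6 that has an edge in common with $C$ (possibly $C$ itself) is bichromatic in the current coloring, calls Address($C'$) for the greatest such cycle $C'$. Then for every real $s$, with probability at least $1-2^{-s}$ the recursive walk halts within $(T_0(|E|,\Delta,|P|)+s)/\delta$ steps, and the coloring it returns is an acyclic edge-coloring of $G$, i.e. a proper edge-coloring without bichromatic cycles. -/

import Mathlib

namespace AEC

/-! ### The recursive walk -/

section RecursiveWalk

variable {Ω ι : Type*} {n : ℕ}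

/-- The greatest element of `B` according to the ordering `prio` (`none` if `B` is empty). -/
noncomputable def greatest (prio : ι ≃ Fin n) (B : Finset ι) : Option ι := by
  classical
  exact if h : B.Nonempty then
    some (prio.symm ((B.image prio).max' (h.image prio))) else none

open Classical in
/-- The flaw that the recursive walk addresses next, together with the stack of calls
`Address(i)` that are pending when the call for this flaw is made (innermost call first).
`U σ` is the set of flaws present in `σ` and `Γ i` the out-neighborhood of `i` in the input
digraph. In the innermost pending call `Address(i)` the greatest flaw of `U σ ∩ Γ i` is
addressed; if there is none, that call returns. With no pending call (the loop of `Eliminate`)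
the greatest flaw of `U σ` is addressed; if there is none, the algorithm halts (`none`). -/
noncomputable def nextCall (prio : ι ≃ Fin n) (U : Ω → Finset ι) (Γ : ι → Finset ι) (σ : Ω) :
    List ι → Option (ι × List ι)
  | [] => (greatest prio (U σ)).map fun j => (j, [])
  | i :: stack =>
    match greatest prio (U σ ∩ Γ i) with
    | some j => some (j, i :: stack)
    | none => nextCall prio U Γ σ stack

/-- One step of the recursive walk: the next flaw `j` is addressed by moving from `σ` to a random
state with law `ρ j σ`. After the algorithm has halted, nothing changes. -/
noncomputable def walkStep (prio : ι ≃ Fin n) (U : Ω → Finset ι) (Γ : ι → Finset ι)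
    (ρ : ι → Ω → PMF Ω) (x : Ω × List ι) : PMF (Ω × List ι) :=
  match nextCall prio U Γ x.1 x.2 with
  | some (j, stack) => (ρ j x.1).map fun τ => (τ, j :: stack)
  | none => PMF.pure x

/-- The law of the current state and the stack of pending calls of the recursive walk after `t`
steps, where the initial state has law `θ`. -/
noncomputable def recursiveWalk (prio : ι ≃ Fin n) (U : Ω → Finset ι) (Γ : ι → Finset ι)
    (ρ : ι → Ω → PMF Ω) (θ : PMF Ω) : ℕ → PMF (Ω × List ι)
  | 0 => θ.map fun σ => (σ, [])
  | t + 1 => (recursiveWalk prio U Γ ρ θ t).bind (walkStep prio U Γ ρ)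

end RecursiveWalk

/-! ### Edge colorings and cycles -/

section Coloring

/-- `C` is the set of edges of a cycle of `G`. -/
def IsCycleSet {V : Type*} (G : SimpleGraph V) (C : Finset G.edgeSet) : Prop :=
  ∃ (v : V) (p : G.Walk v v), p.IsCycle ∧ ∀ e : G.edgeSet, e ∈ C ↔ (e : Sym2 V) ∈ p.edges

variable {V : Type*} {G : SimpleGraph V} {P : Type*}

/-- The edges of `C` are all colored and receive exactly two colors. Partial edge-colorings are
functions to `Option P`, where `none` means uncolored. -/
def Bichromatic (s : G.edgeSet → Option P) (C : Finset G.edgeSet) : Prop :=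
  ∃ a b : P, a ≠ b ∧ s '' (C : Set G.edgeSet) = {some a, some b}

/-- Edges that share a vertex have distinct colors. -/
def IsProper (σ : G.edgeSet → P) : Prop :=
  ∀ e f : G.edgeSet, G.lineGraph.Adj e f → σ e ≠ σ f

/-- A total edge-coloring, seen as a partial one. -/
def toPartial (σ : G.edgeSet → P) : G.edgeSet → Option P := fun e => some (σ e)

/-- Acyclic edge-colorings: proper, and without bichromatic cycles. -/
def IsAcyclicColoring (σ : G.edgeSet → P) : Prop :=
  IsProper σ ∧ ∀ C : Finset G.edgeSet, IsCycleSet G C → ¬ Bichromatic (toPartial σ) C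

open Classical in
/-- Color `c` is 4-forbidden for `e` in the partial edge-coloring `s`: giving `e` the color `c`
makes `e` agree in color with an edge sharing a vertex with it, or creates a bichromatic 4-cycle
through `e`. -/
def FourForbidden (s : G.edgeSet → Option P) (e : G.edgeSet) (c : P) : Prop :=
  (∃ f : G.edgeSet, G.lineGraph.Adj e f ∧ s f = some c) ∨
    ∃ C : Finset G.edgeSet, IsCycleSet G C ∧ C.card = 4 ∧ e ∈ C ∧
      Bichromatic (Function.update s e (some c)) C

open Classical in
/-- The 4-available colors for `e`. -/
noncomputable def fourAvailable [Fintype P] (s : G.edgeSet → Option P) (e : G.edgeSet) :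
    Finset P :=
  Finset.univ.filter fun c => ¬ FourForbidden s e c

open Classical in
/-- Color the edges of the list one after the other, giving each the greatest color that is
4-available at that time (an edge for which there is none would stay uncolored). -/
noncomputable def greedyColoring [Fintype P] [LinearOrder P] (order : List G.edgeSet) :
    G.edgeSet → Option P :=
  order.foldl
    (fun s e => Function.update s e
      (if h : (fourAvailable s e).Nonempty then some ((fourAvailable s e).max' h) else none))
    (fun _ => none)

open Classical in
/-- `CanRecolor L s s'`: the partial coloring `s'` may result from `s` by going through the list
`L` and giving each edge one of the colors that are 4-available for it at that time. -/
def CanRecolor [Fintype P] :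
    List G.edgeSet → (G.edgeSet → Option P) → (G.edgeSet → Option P) → Prop
  | [], s, s' => s' = s
  | e :: L, s, s' => ∃ c ∈ fourAvailable s e, CanRecolor L (Function.update s e (some c)) s'

open Classical in
/-- Uncolor the edges of the list `L`. -/
noncomputable def uncolor (L : List G.edgeSet) (s : G.edgeSet → Option P) :
    G.edgeSet → Option P :=
  fun e => if e ∈ L then none else s e

variable (G P)

/-- The state space: proper edge-colorings of `G` without bichromatic 4-cycles. -/
def State : Type _ :=
  {σ : G.edgeSet → P // IsProper σ ∧
    ∀ C : Finset G.edgeSet, IsCycleSet G C → C.card = 4 → ¬ Bichromatic (toPartial σ) C}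

/-- The even cycles of length at least 6 of `G` (as edge sets), which index the flaws. -/
def EvenCycle : Type _ :=
  {C : Finset G.edgeSet // IsCycleSet G C ∧ Even C.card ∧ 6 ≤ C.card}

variable {G P}

instance [Finite V] [Finite P] : Finite (State G P) := Subtype.finite
instance [Finite V] : Finite (EvenCycle G) := Subtype.finite

/-- `L` lists the edges of the cycle `C` in the order of a traversal. Its first two entries are
the two adjacent edges `e₁, e₂` of `C` that keep their colors when `C` is recolored; every ordered
pair of adjacent edges of `C` arises from exactly one such list. -/
def IsTraversal (C : EvenCycle G) (L : List G.edgeSet) : Prop :=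
  (∀ e, e ∈ L ↔ e ∈ C.1) ∧
    ∃ (v : V) (p : G.Walk v v), p.IsCycle ∧ L.map (fun e => (e : Sym2 V)) = p.edges

/-- The flaws present in `σ`: the even cycles of length at least 6 that are bichromatic. -/
noncomputable def presentFlaws [Finite V] (σ : State G P) : Finset (EvenCycle G) :=
  (Set.toFinite {C : EvenCycle G | Bichromatic (toPartial σ.1) C.1}).toFinset

/-- The out-neighborhood of `C` in the digraph with arcs in both directions between any two
cycles that have an edge in common (in particular, a loop at every cycle). -/
noncomputable def cycleNbhd [Finite V] (C : EvenCycle G) : Finset (EvenCycle G) :=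
  (Set.toFinite {C' : EvenCycle G | ∃ e, e ∈ C.1 ∧ e ∈ C'.1}).toFinset

/-- The actions for a cycle traversed by the list `L`: all states that may result from uncoloring
all its edges except for the first two of `L`, and then giving each uncolored edge, in the order
of `L`, one of its 4-available colors. -/
noncomputable def actions [Finite V] [Fintype P] (L : List G.edgeSet) (σ : State G P) :
    Finset (State G P) :=
  (Set.toFinite {τ : State G P |
    CanRecolor (L.drop 2) (uncolor (L.drop 2) (toPartial σ.1)) (toPartial τ.1)}).toFinset

open Classical in
/-- The transition probabilities, harmonic with respect to the uniform measure on the states: the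
uniform distribution on the set of actions. (If there were no action, the walk would be stuck at
`σ` forever.) -/
noncomputable def transition [Finite V] [Fintype P] (L : List G.edgeSet) (σ : State G P) :
    PMF (State G P) :=
  if h : (actions L σ).Nonempty then PMF.uniformOfFinset (actions L σ) h else PMF.pure σ

end Coloring

end AEC

/-!
The probability that the recursive walk has not halted after `t` steps decays exponentially in `t`.
The proof bounds it by weights attached to the stack of pending calls.

**The walk.** Fix a set of flaws `B` for each pending call, containing the flaws that the call may
still address. When a call addresses `c`, the flaws present afterwards were present before or are
neighbors of `c`; hence when `Address(c)` returns, the calling level may only continue with flaws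
of `B` that come before `c` in the ordering and are not neighbors of `c` (`Compatible`,
`remaining`). The flaws addressed on one level are therefore an independent set, listed in
decreasing order, and a level carries the weight `indepSum B = ∑_S ∏_{j ∈ S} ψ j` over the
independent sets `S ⊆ B`. Instead of single trajectories one follows
distributions of mass on the states with at most `K` on each state. If the transitions into a given
state that address `c` have total probability at most `γ c`, then addressing `c` turns the bound
`K` into `K * γ c`. With the local lemma condition `γ c * indepSum (Γ c) ≤ r * ψ c`, the bound on
the surviving mass gains a factor `r` in each step (`tsum_mul_survival_le`), so that the survival probability after `t` steps is at most
`|Ω| * r ^ t * indepSum univ` (`recursiveWalk_toOuterMeasure_le`).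

**The colorings.** At most `2(Δ - 1)` colors are 4-forbidden for an edge
(`card_fourForbidden_le`), which leaves `m ≥ 2.182(Δ - 1)` available colors, so that a cycle `C` has
at least `m ^ (|C| - 2)` actions. Since a bichromatic cycle alternates, the state before an action
is determined by the state after it (`eq_of_mem_actions_of_mem_presentFlaws`); thus
`γ C = m ^ (-(|C| - 2))` is admissible (`tsum_transition_le`). There are at most
`(Δ - 1) ^ (k - 2)` cycles of length `k` through an edge (`card_cycles_through_le`). With
`ψ C = (0.57 / (Δ - 1)) ^ (|C| - 2)` the cycles through an edge have total weight at most
`0.57 ^ 4 / (1 - 0.57 ^ 2) < 0.1564`, and an independent set has at most one cycle through each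
edge, so that `indepSum (Γ C) ≤ 1.1564 ^ |C|` (`indepSum_le_one_add_pow`). As
`1.1564 ^ 3 < (2.182 * 0.57) ^ 2`, the local lemma condition holds with some `r < 1`.
-/

namespace AEC

/-! ### Independent sets of flaws -/

section Walk

open scoped ENNReal

variable {Ω ι : Type*} {n : ℕ}

open Classical in
/-- The generating function `∑_S ∏_{j ∈ S} ψ j` of the subsets `S` of `B` in which no flaw is an
out-neighbor of another. -/
noncomputable def indepSum (Γ : ι → Finset ι) (ψ : ι → ℝ≥0∞) (B : Finset ι) : ℝ≥0∞ :=
  ∑ S ∈ B.powerset.filter fun S : Finset ι => (S : Set ι).Pairwise fun a b => b ∉ Γ a,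
    ∏ j ∈ S, ψ j

lemma indepSum_mono (Γ : ι → Finset ι) (ψ : ι → ℝ≥0∞) {B B' : Finset ι} (h : B ⊆ B') :
    indepSum Γ ψ B ≤ indepSum Γ ψ B' := by
  classical
  unfold indepSum
  apply Finset.sum_le_sum_of_subset
  intro S hS
  simp only [Finset.mem_filter, Finset.mem_powerset] at hS ⊢
  exact ⟨hS.1.trans h, hS.2⟩

lemma indepSum_empty (Γ : ι → Finset ι) (ψ : ι → ℝ≥0∞) : indepSum Γ ψ ∅ = 1 := by
  classical
  unfold indepSum
  rw [Finset.powerset_empty, Finset.filter_singleton]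
  simp

lemma one_le_indepSum (Γ : ι → Finset ι) (ψ : ι → ℝ≥0∞) (B : Finset ι) :
    1 ≤ indepSum Γ ψ B :=
  (indepSum_empty Γ ψ).symm.le.trans (indepSum_mono Γ ψ (Finset.empty_subset B))

open Classical in
/-- The flaws of `B` that can still be addressed after `c` on the same level of the recursion. -/
noncomputable def remaining (prio : ι ≃ Fin n) (Γ : ι → Finset ι) (B : Finset ι) (c : ι) :
    Finset ι :=
  B.filter fun b => prio b < prio c ∧ b ∉ Γ c

/-- Splitting the nonempty independent sets by their greatest element. -/
lemma one_add_sum_remaining_le (prio : ι ≃ Fin n) {Γ : ι → Finset ι} (ψ : ι → ℝ≥0∞)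
    (hsymm : ∀ a b, b ∈ Γ a → a ∈ Γ b) (B : Finset ι) :
    1 + ∑ c ∈ B, ψ c * indepSum Γ ψ (remaining prio Γ B c) ≤ indepSum Γ ψ B := by
  classical
  have key : ∑ c ∈ B, ψ c * indepSum Γ ψ (remaining prio Γ B c) =
      ∑ x ∈ B.sigma (fun c => (remaining prio Γ B c).powerset.filter
        fun S : Finset ι => (S : Set ι).Pairwise fun a b => b ∉ Γ a),
          ∏ j ∈ insert x.1 x.2, ψ j := by
    rw [Finset.sum_sigma]
    refine Finset.sum_congr rfl fun c _ => ?_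
    rw [indepSum, Finset.mul_sum]
    refine Finset.sum_congr rfl fun S hS => ?_
    rw [Finset.prod_insert]
    intro hc
    have := (Finset.mem_powerset.1 (Finset.mem_filter.1 hS).1) hc
    simp [remaining] at this
  have hlt : ∀ (c : ι) (S : Finset ι), S ⊆ remaining prio Γ B c → ∀ b ∈ S,
      b ∈ B ∧ prio b < prio c ∧ b ∉ Γ c := by
    intro c S hS b hb
    have := hS hb
    simpa [remaining] using this
  have hinj : Set.InjOn (fun x : (_ : ι) × Finset ι => insert x.1 x.2)
      (B.sigma (fun c => (remaining prio Γ B c).powerset.filter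
        fun S : Finset ι => (S : Set ι).Pairwise fun a b => b ∉ Γ a) :
          Set ((_ : ι) × Finset ι)) := by
    rintro ⟨c, S⟩ hS ⟨c', S'⟩ hS' heq
    simp only [Finset.coe_sigma, Set.mem_sigma_iff, Finset.mem_coe, Finset.mem_filter,
      Finset.mem_powerset] at hS hS' heq
    have h1 := hlt c S hS.2.1
    have h2 := hlt c' S' hS'.2.1
    have hcc : c = c' := by
      have hc : c ∈ insert c' S' := heq ▸ Finset.mem_insert_self c S
      have hc' : c' ∈ insert c S := heq ▸ Finset.mem_insert_self c' S'
      rcases Finset.mem_insert.1 hc with h | h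
      · exact h
      rcases Finset.mem_insert.1 hc' with h' | h'
      · exact h'.symm
      exact absurd ((h1 _ h').2.1.trans (h2 _ h).2.1) (lt_irrefl _)
    subst hcc
    have hc1 : c ∉ S := fun h => lt_irrefl _ (h1 _ h).2.1
    have hc2 : c ∉ S' := fun h => lt_irrefl _ (h2 _ h).2.1
    have : S = S' := by
      rw [← Finset.erase_insert hc1, ← Finset.erase_insert hc2, heq]
    rw [this]
  rw [key, ← Finset.sum_image (f := fun S => ∏ j ∈ S, ψ j) hinj]
  have h0 : (∅ : Finset ι) ∉ (B.sigma (fun c => (remaining prio Γ B c).powerset.filter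
        fun S : Finset ι => (S : Set ι).Pairwise fun a b => b ∉ Γ a)).image
        (fun x : (_ : ι) × Finset ι => insert x.1 x.2) := by
    intro h
    obtain ⟨x, -, hx⟩ := Finset.mem_image.1 h
    exact Finset.insert_ne_empty _ _ hx
  have h1 := Finset.sum_insert (f := fun S : Finset ι => ∏ j ∈ S, ψ j) h0
  rw [Finset.prod_empty] at h1
  rw [← h1, indepSum]
  apply Finset.sum_le_sum_of_subset
  intro T hT
  rcases Finset.mem_insert.1 hT with rfl | hT
  · simp
  obtain ⟨⟨c, S⟩, hx, rfl⟩ := Finset.mem_image.1 hT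
  simp only [Finset.mem_sigma, Finset.mem_filter, Finset.mem_powerset] at hx ⊢
  have h2 := hlt c S hx.2.1
  refine ⟨Finset.insert_subset hx.1 fun b hb => (h2 b hb).1, ?_⟩
  rw [Finset.coe_insert]
  refine hx.2.2.insert fun b hb _ => ⟨(h2 b hb).2.2, fun h => (h2 b hb).2.2 (hsymm _ _ h)⟩

/-! ### Survival of the recursive walk -/

lemma mem_of_greatest_eq_some {prio : ι ≃ Fin n} {B : Finset ι} {j : ι}
    (h : greatest prio B = some j) : j ∈ B ∧ ∀ b ∈ B, prio b ≤ prio j := by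
  classical
  unfold greatest at h
  split_ifs at h with hB
  have hj : (B.image prio).max' (hB.image prio) = prio j := by
    rw [← Option.some.inj h, Equiv.apply_symm_apply]
  constructor
  · have := Finset.max'_mem _ (hB.image prio)
    rw [hj] at this
    obtain ⟨b, hb, hbj⟩ := Finset.mem_image.1 this
    rwa [← prio.injective hbj]
  · intro b hb
    rw [← hj]
    exact Finset.le_max' _ _ (Finset.mem_image_of_mem _ hb)

lemma greatest_eq_none_iff {prio : ι ≃ Fin n} {B : Finset ι} :
    greatest prio B = none ↔ B = ∅ := by
  classical
  unfold greatest
  split_ifs with hB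
  · simp [hB.ne_empty]
  · simpa [Finset.not_nonempty_iff_eq_empty] using hB

variable (prio : ι ≃ Fin n) (U : Ω → Finset ι) (Γ : ι → Finset ι) (ρ : ι → Ω → PMF Ω)

/-- The walk halts only when no flaw is left, whatever calls are pending. -/
lemma nextCall_eq_none_iff (σ : Ω) (st : List ι) :
    nextCall prio U Γ σ st = none ↔ U σ = ∅ := by
  classical
  induction st with
  | nil => simp [nextCall, greatest_eq_none_iff]
  | cons i st ih =>
    rw [nextCall]
    split
    · rename_i j hj
      have := (mem_of_greatest_eq_some hj).1
      simp only [reduceCtorEq, false_iff]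
      intro h
      simp [h] at this
    · exact ih

open Classical in
/-- The probability that the recursive walk, at state `σ` with the given stack of pending calls,
has a flaw left after its next `t` steps. -/
noncomputable def survival : ℕ → List ι → Ω → ℝ≥0∞
  | 0, _, σ => if U σ = ∅ then 0 else 1
  | t + 1, st, σ =>
    match nextCall prio U Γ σ st with
    | some (j, st') => ∑' τ, ρ j σ τ * survival t (j :: st') τ
    | none => 0

lemma survival_eq_zero (t : ℕ) (st : List ι) {σ : Ω} (h : U σ = ∅) :
    survival prio U Γ ρ t st σ = 0 := by
  cases t with
  | zero => simp [survival, h]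
  | succ t => rw [survival, (nextCall_eq_none_iff prio U Γ σ st).2 h]

lemma survival_zero_le_one (st : List ι) (σ : Ω) : survival prio U Γ ρ 0 st σ ≤ 1 := by
  rw [survival]
  split_ifs <;> simp

lemma tsum_walkStep_mul_survival (t : ℕ) (x : Ω × List ι) :
    ∑' y, walkStep prio U Γ ρ x y * survival prio U Γ ρ t y.2 y.1 =
      survival prio U Γ ρ (t + 1) x.2 x.1 := by
  classical
  rw [survival, walkStep]
  split
  · rename_i j st h
    simp only [PMF.map_apply, ← ENNReal.tsum_mul_right]
    rw [ENNReal.tsum_comm]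
    refine tsum_congr fun τ => ?_
    rw [tsum_eq_single (τ, j :: st)]
    · simp
    · intro y hy
      simp [hy]
  · rename_i h
    have h0 := (nextCall_eq_none_iff prio U Γ x.1 x.2).1 h
    rw [tsum_eq_single x]
    · simp [survival_eq_zero prio U Γ ρ t x.2 h0]
    · intro y hy
      simp [hy]

lemma tsum_recursiveWalk_mul_survival (θ : PMF Ω) (t r : ℕ) :
    ∑' x, recursiveWalk prio U Γ ρ θ t x * survival prio U Γ ρ r x.2 x.1 =
      ∑' σ, θ σ * survival prio U Γ ρ (t + r) [] σ := by
  classical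
  induction t generalizing r with
  | zero =>
    simp only [recursiveWalk, PMF.map_apply, ← ENNReal.tsum_mul_right, zero_add]
    rw [ENNReal.tsum_comm]
    refine tsum_congr fun σ => ?_
    rw [tsum_eq_single (σ, [])]
    · simp
    · intro y hy
      simp [hy]
  | succ t ih =>
    simp only [recursiveWalk, PMF.bind_apply, ← ENNReal.tsum_mul_right]
    rw [ENNReal.tsum_comm]
    simp only [mul_assoc, ENNReal.tsum_mul_left, tsum_walkStep_mul_survival]
    rw [ih, Nat.add_right_comm, Nat.add_assoc]

/-- The walk has a flaw left after `t` steps with the survival probability of its start. -/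
lemma recursiveWalk_toOuterMeasure_ne_empty (θ : PMF Ω) (t : ℕ) :
    (recursiveWalk prio U Γ ρ θ t).toOuterMeasure {x | U x.1 ≠ ∅} =
      ∑' σ, θ σ * survival prio U Γ ρ t [] σ := by
  classical
  have := tsum_recursiveWalk_mul_survival prio U Γ ρ θ t 0
  rw [add_zero] at this
  rw [← this, PMF.toOuterMeasure_apply]
  refine tsum_congr fun x => ?_
  by_cases h : U x.1 = ∅ <;> simp [survival, h]

open Classical in
/-- `Compatible Γ B₀ u A Q`: the set `u` of present flaws is consistent with the pending calls
`Q`, listed innermost first, each with the set of flaws that it may still call. Every present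
flaw of a level is in the set for this level or is a neighbor of a pending call further in. The
set `A` collects the neighbors of the calls further in, and `B₀` is the set for the main loop. -/
def Compatible (Γ : ι → Finset ι) (B₀ : Finset ι) (u : Finset ι) :
    Finset ι → List (ι × Finset ι) → Prop
  | A, [] => u ⊆ B₀ ∪ A
  | A, q :: Q => u ∩ Γ q.1 ⊆ q.2 ∪ A ∧ Compatible Γ B₀ u (A ∪ Γ q.1) Q

variable {Γ} in
/-- Compatibility survives if the only new flaws, those in `D`, are accounted for by `A'`. -/
lemma Compatible.step {B₀ u u' A A' D : Finset ι} {Q : List (ι × Finset ι)}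
    (h : Compatible Γ B₀ u A Q) (hu : ∀ f ∈ u', f ∈ u ∨ f ∈ D)
    (hA : ∀ f ∈ u, f ∈ A → f ∈ A') (hD : D ⊆ A') : Compatible Γ B₀ u' A' Q := by
  classical
  induction Q generalizing A A' with
  | nil =>
    intro f hf
    rw [Finset.mem_union]
    rcases hu f hf with h1 | h1
    · rcases Finset.mem_union.1 (h h1) with h2 | h2
      · exact Or.inl h2
      · exact Or.inr (hA f h1 h2)
    · exact Or.inr (hD h1)
  | cons q Q ih =>
    refine ⟨fun f hf => ?_, ih h.2 (fun f hf h2 => ?_)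
      (hD.trans Finset.subset_union_left)⟩
    · rw [Finset.mem_inter] at hf
      rw [Finset.mem_union]
      rcases hu f hf.1 with h1 | h1
      · rcases Finset.mem_union.1 (h.1 (Finset.mem_inter.2 ⟨h1, hf.2⟩)) with h2 | h2
        · exact Or.inl h2
        · exact Or.inr (hA f h1 h2)
      · exact Or.inr (hD h1)
    · rw [Finset.mem_union] at h2 ⊢
      exact h2.imp (hA f hf) id

open Classical in
lemma tsum_eq_sum_fibers {g : Ω → Option ι} {B : Finset ι} {f : Ω → ℝ≥0∞}
    (h : ∀ σ, f σ ≠ 0 → ∀ c, g σ = some c → c ∈ B) :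
    ∑' σ, f σ = ∑ c ∈ B, ∑' σ, (if g σ = some c then f σ else 0) +
      ∑' σ, (if g σ = none then f σ else 0) := by
  rw [← Summable.tsum_finsetSum (fun _ _ => ENNReal.summable), ← ENNReal.tsum_add]
  refine tsum_congr fun σ => ?_
  by_cases h0 : f σ = 0
  · simp [h0]
  cases hg : g σ with
  | none => simp
  | some c => simp [h σ h0 c hg]

variable {prio U Γ ρ}

open Classical in
/-- Masses `v ≤ K` whose next call is `c` become masses at most `K * γ c`. -/
lemma tsum_survival_call_le {γ : ι → ℝ≥0∞}
    (hγ : ∀ c τ, ∑' σ, (if c ∈ U σ then ρ c σ τ else 0) ≤ γ c)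
    (v : Ω → ℝ≥0∞) (K : ℝ≥0∞) (hv : ∀ σ, v σ ≤ K) (g : Ω → Option ι) (c : ι)
    (hg : ∀ σ, v σ ≠ 0 → g σ = some c → c ∈ U σ) (F : Ω → ℝ≥0∞) (R : ℝ≥0∞)
    (hF : ∀ w : Ω → ℝ≥0∞, (∀ τ, w τ ≤ K * γ c) →
      (∀ τ, w τ ≠ 0 → ∃ σ, v σ ≠ 0 ∧ g σ = some c ∧ ρ c σ τ ≠ 0) →
      ∑' τ, w τ * F τ ≤ R) :
    ∑' σ, (if g σ = some c then v σ * ∑' τ, ρ c σ τ * F τ else 0) ≤ R := by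
  have h1 : ∑' σ, (if g σ = some c then v σ * ∑' τ, ρ c σ τ * F τ else 0) =
      ∑' τ, (∑' σ, (if g σ = some c then v σ * ρ c σ τ else 0)) * F τ := by
    simp only [← ENNReal.tsum_mul_right]
    rw [ENNReal.tsum_comm]
    refine tsum_congr fun σ => ?_
    split_ifs
    · rw [← ENNReal.tsum_mul_left]
      exact tsum_congr fun τ => (mul_assoc _ _ _).symm
    · simp
  rw [h1]
  apply hF
  · intro τ
    refine le_trans ?_ (mul_le_mul_right (hγ c τ) K)
    rw [← ENNReal.tsum_mul_left]
    refine ENNReal.tsum_le_tsum fun σ => ?_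
    split_ifs with h2 h3
    · exact mul_le_mul_left (hv σ) _
    · have : v σ = 0 := by
        by_contra h4
        exact h3 (hg σ h4 h2)
      simp [this]
    · simp
    · simp
  · intro τ hτ
    rw [Ne, ENNReal.tsum_eq_zero] at hτ
    push Not at hτ
    obtain ⟨σ, hσ⟩ := hτ
    refine ⟨σ, ?_⟩
    split_ifs at hσ with h2
    · exact ⟨left_ne_zero_of_mul hσ, h2, right_ne_zero_of_mul hσ⟩
    · exact absurd rfl hσ

/-- The weight of the recursion levels of the pending calls. -/
noncomputable def levelWeight (Γ : ι → Finset ι) (ψ : ι → ℝ≥0∞) (B₀ : Finset ι)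
    (Q : List (ι × Finset ι)) : ℝ≥0∞ :=
  (Q.map fun q => indepSum Γ ψ q.2).prod * indepSum Γ ψ B₀

lemma levelWeight_cons (Γ : ι → Finset ι) (ψ : ι → ℝ≥0∞) (B₀ : Finset ι) (q : ι × Finset ι)
    (Q : List (ι × Finset ι)) :
    levelWeight Γ ψ B₀ (q :: Q) = indepSum Γ ψ q.2 * levelWeight Γ ψ B₀ Q := by
  simp [levelWeight, mul_assoc]

lemma one_le_levelWeight (Γ : ι → Finset ι) (ψ : ι → ℝ≥0∞) (B₀ : Finset ι)
    (Q : List (ι × Finset ι)) : 1 ≤ levelWeight Γ ψ B₀ Q := by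
  induction Q with
  | nil => simpa [levelWeight] using one_le_indepSum Γ ψ B₀
  | cons q Q ih =>
    rw [levelWeight_cons]
    exact one_le_mul (one_le_indepSum Γ ψ _) ih

/-- The local lemma condition bounds the total weight of the configurations after one step, with a
call `c ∈ B` on the current level or, in the last summand, on a level further out. -/
lemma sum_calls_le {γ ψ : ι → ℝ≥0∞} {r : ℝ≥0∞}
    (hsymm : ∀ a b, b ∈ Γ a → a ∈ Γ b)
    (hψ : ∀ c, γ c * indepSum Γ ψ (Γ c) ≤ r * ψ c) (B : Finset ι) (M W : ℝ≥0∞) :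
    ∑ c ∈ B, M * γ c * (indepSum Γ ψ (Γ c) * (indepSum Γ ψ (remaining prio Γ B c) * W)) +
      M * r * W ≤ M * r * (indepSum Γ ψ B * W) := by
  calc _ ≤ ∑ c ∈ B, M * r * W * (ψ c * indepSum Γ ψ (remaining prio Γ B c)) + M * r * W := by
        refine add_le_add_left (Finset.sum_le_sum fun c _ => ?_) _
        calc _ = (γ c * indepSum Γ ψ (Γ c)) * (M * indepSum Γ ψ (remaining prio Γ B c) * W) := by
              ring
          _ ≤ (r * ψ c) * (M * indepSum Γ ψ (remaining prio Γ B c) * W) :=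
              mul_le_mul_left (hψ c) _
          _ = _ := by ring
    _ = M * r * W * (1 + ∑ c ∈ B, ψ c * indepSum Γ ψ (remaining prio Γ B c)) := by
        rw [← Finset.mul_sum]; ring
    _ ≤ M * r * W * indepSum Γ ψ B :=
        mul_le_mul_right (one_add_sum_remaining_le prio ψ hsymm B) _
    _ = _ := by ring

open Classical in
/-- The inductive step for one level of the recursion: `g` is the next call on this level, `F` the
survival after the call, and `G` the survival if the level has no further call. -/
lemma tsum_level_le {γ ψ : ι → ℝ≥0∞} {r : ℝ≥0∞}
    (hsymm : ∀ a b, b ∈ Γ a → a ∈ Γ b)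
    (hγ : ∀ c τ, ∑' σ, (if c ∈ U σ then ρ c σ τ else 0) ≤ γ c)
    (hψ : ∀ c, γ c * indepSum Γ ψ (Γ c) ≤ r * ψ c)
    {v : Ω → ℝ≥0∞} {K : ℝ≥0∞} (hv : ∀ σ, v σ ≤ K) (g : Ω → Option ι) (B : Finset ι)
    (hg : ∀ σ c, v σ ≠ 0 → g σ = some c → c ∈ B ∧ c ∈ U σ)
    (F : ι → Ω → ℝ≥0∞) (G H : Ω → ℝ≥0∞)
    (hHs : ∀ σ c, g σ = some c → H σ = ∑' τ, ρ c σ τ * F c τ)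
    (hHn : ∀ σ, g σ = none → H σ = G σ) {M W : ℝ≥0∞}
    (hF : ∀ c ∈ B, ∀ w : Ω → ℝ≥0∞, (∀ τ, w τ ≤ K * γ c) →
      (∀ τ, w τ ≠ 0 → ∃ σ, v σ ≠ 0 ∧ g σ = some c ∧ ρ c σ τ ≠ 0) →
      ∑' τ, w τ * F c τ ≤
        M * γ c * (indepSum Γ ψ (Γ c) * (indepSum Γ ψ (remaining prio Γ B c) * W)))
    (hG : ∑' σ, (if g σ = none then v σ else 0) * G σ ≤ M * r * W) :
    ∑' σ, v σ * H σ ≤ M * r * (indepSum Γ ψ B * W) := by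
  refine le_trans ?_ (sum_calls_le (prio := prio) hsymm hψ B M W)
  rw [tsum_eq_sum_fibers (g := g) (B := B)
    fun σ hσ c hc => (hg σ c (left_ne_zero_of_mul hσ) hc).1]
  refine add_le_add (Finset.sum_le_sum fun c hc => ?_) (le_trans (le_of_eq ?_) hG)
  · refine le_trans (le_of_eq (tsum_congr fun σ => ?_))
      (tsum_survival_call_le hγ v K hv g c (fun σ h0 h => (hg σ c h0 h).2) (F c) _ (hF c hc))
    split_ifs with h
    · rw [hHs σ c h]
    · rfl
  · refine tsum_congr fun σ => ?_
    split_ifs with h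
    · rw [hHn σ h]
    · rw [zero_mul]

/-- The total mass that survives `t` steps, if it starts with at most `K` on each state and only on
states compatible with the pending calls. By induction on `t` and on the stack: the mass that makes
the call `c` next is spread over the states with at most `K * γ c` on each, and the sum over the
possible calls of a level is controlled by `one_add_sum_remaining_le`. -/
lemma tsum_mul_survival_le {γ ψ : ι → ℝ≥0∞} {r : ℝ≥0∞}
    (hsymm : ∀ a b, b ∈ Γ a → a ∈ Γ b) (hloop : ∀ a, a ∈ Γ a)
    (hcause : ∀ c σ τ, c ∈ U σ → ρ c σ τ ≠ 0 → ∀ f ∈ U τ, f ∈ U σ ∨ f ∈ Γ c)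
    (hγ : ∀ c τ, ∑' σ, (open Classical in if c ∈ U σ then ρ c σ τ else 0) ≤ γ c)
    (hψ : ∀ c, γ c * indepSum Γ ψ (Γ c) ≤ r * ψ c)
    (B₀ : Finset ι) (t : ℕ) (Q : List (ι × Finset ι)) (v : Ω → ℝ≥0∞) (K : ℝ≥0∞)
    (hv : ∀ σ, v σ ≤ K) (hQ : ∀ σ, v σ ≠ 0 → Compatible Γ B₀ (U σ) ∅ Q) :
    ∑' σ, v σ * survival prio U Γ ρ t (Q.map Prod.fst) σ ≤
      (∑' _ : Ω, 1) * K * r ^ t * levelWeight Γ ψ B₀ Q := by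
  classical
  induction t generalizing B₀ Q v K with
  | zero =>
    calc _ ≤ ∑' σ : Ω, K * 1 := ENNReal.tsum_le_tsum fun σ =>
          mul_le_mul' (hv σ) (survival_zero_le_one prio U Γ ρ _ σ)
      _ = (∑' _ : Ω, 1) * K := by rw [ENNReal.tsum_mul_left, mul_comm]
      _ ≤ _ := by
          rw [pow_zero, mul_one]
          exact le_mul_of_one_le_right' (one_le_levelWeight Γ ψ B₀ Q)
  | succ t iht =>
    -- A flaw present after the call `c` is a neighbor of `c`, or was present before.
    have hrem : ∀ (c : ι) (A B : Finset ι) (σ τ : Ω), c ∈ U σ → ρ c σ τ ≠ 0 →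
        (∀ f ∈ U σ, f ∈ A → f ∈ B ∧ prio f ≤ prio c) →
        ∀ f ∈ U τ, f ∈ A → f ∈ remaining prio Γ B c ∪ Γ c := by
      intro c A B σ τ hc hρ hA f hf hfA
      rw [Finset.mem_union]
      by_cases hfc : f ∈ Γ c
      · exact Or.inr hfc
      · have h1 := hA f ((hcause c σ τ hc hρ f hf).resolve_right hfc) hfA
        refine Or.inl ?_
        simp only [remaining, Finset.mem_filter]
        refine ⟨h1.1, lt_of_le_of_ne h1.2 fun h2 => hfc ?_, hfc⟩
        rw [prio.injective h2]
        exact hloop c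
    induction Q generalizing v with
    | nil =>
      have hB : ∀ σ, v σ ≠ 0 → U σ ⊆ B₀ := fun σ hσ => by
        simpa [Compatible] using hQ σ hσ
      have := tsum_level_le (prio := prio) (v := v) hsymm hγ hψ hv
        (fun σ => greatest prio (U σ)) B₀
        (fun σ c h0 h => ⟨hB σ h0 (mem_of_greatest_eq_some h).1, (mem_of_greatest_eq_some h).1⟩)
        (fun c => survival prio U Γ ρ t [c]) (fun _ => 0) (survival prio U Γ ρ (t + 1) [])
        (fun σ c h => by simp [survival, nextCall, h])
        (fun σ h => by simp [survival, nextCall, h])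
        (M := (∑' _ : Ω, 1) * K * r ^ t) (W := 1) ?_ (by simp)
      · refine this.trans_eq ?_
        simp only [levelWeight, List.map_nil, List.prod_nil]
        ring
      · intro c _ w hw hw'
        refine (iht (remaining prio Γ B₀ c) [(c, Γ c)] w (K * γ c) hw fun τ hτ => ?_).trans_eq ?_
        · obtain ⟨σ, hσ, hc, hρ⟩ := hw' τ hτ
          refine ⟨Finset.inter_subset_right.trans Finset.subset_union_left, fun f hf => ?_⟩
          have := hrem c (U σ) B₀ σ τ (mem_of_greatest_eq_some hc).1 hρ
            (fun f hf _ => ⟨hB σ hσ hf, (mem_of_greatest_eq_some hc).2 f hf⟩)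
          rcases hcause c σ τ (mem_of_greatest_eq_some hc).1 hρ f hf with h | h
          · simpa using this f hf h
          · simp [h]
        · simp only [levelWeight, List.map_cons, List.map_nil, List.prod_cons, List.prod_nil]
          ring
    | cons q Q ihQ =>
      have hmem : ∀ σ c, greatest prio (U σ ∩ Γ q.1) = some c → c ∈ U σ ∧ c ∈ Γ q.1 :=
        fun σ c h => Finset.mem_inter.1 (mem_of_greatest_eq_some h).1
      have hB : ∀ σ, v σ ≠ 0 → U σ ∩ Γ q.1 ⊆ q.2 := fun σ hσ => by
        simpa using (hQ σ hσ).1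
      have := tsum_level_le (prio := prio) (v := v) hsymm hγ hψ hv
        (fun σ => greatest prio (U σ ∩ Γ q.1)) q.2
        (fun σ c h0 h => ⟨hB σ h0 (mem_of_greatest_eq_some h).1, (hmem σ c h).1⟩)
        (fun c => survival prio U Γ ρ t (c :: q.1 :: Q.map Prod.fst))
        (survival prio U Γ ρ (t + 1) (Q.map Prod.fst))
        (survival prio U Γ ρ (t + 1) (q.1 :: Q.map Prod.fst))
        (fun σ c h => by simp [survival, nextCall, h])
        (fun σ h => by simp [survival, nextCall, h])
        (M := (∑' _ : Ω, 1) * K * r ^ t) (W := levelWeight Γ ψ B₀ Q) ?_ ?_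
      · refine this.trans_eq ?_
        rw [levelWeight_cons, pow_succ]
        ring
      · intro c _ w hw hw'
        refine (iht B₀ ((c, Γ c) :: (q.1, remaining prio Γ q.2 c) :: Q) w (K * γ c) hw
          fun τ hτ => ?_).trans_eq ?_
        · obtain ⟨σ, hσ, hc, hρ⟩ := hw' τ hτ
          refine ⟨Finset.inter_subset_right.trans Finset.subset_union_left, ?_, ?_⟩
          · intro f hf
            rw [Finset.mem_inter] at hf
            have := hrem c (Γ q.1) q.2 σ τ (hmem σ c hc).1 hρ
              (fun f hf hf' => ⟨hB σ hσ (Finset.mem_inter.2 ⟨hf, hf'⟩),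
                (mem_of_greatest_eq_some hc).2 f (Finset.mem_inter.2 ⟨hf, hf'⟩)⟩) f hf.1 hf.2
            simpa using this
          · refine (hQ σ hσ).2.step (hcause c σ τ (hmem σ c hc).1 hρ) (fun f _ hf => ?_) ?_
            · simp only [Finset.mem_union] at hf ⊢
              exact Or.inr (hf.resolve_left (Finset.notMem_empty f))
            · intro f hf
              simp [hf]
        · rw [levelWeight_cons, levelWeight_cons]
          ring
      · refine (ihQ _ (fun σ => ?_) fun σ hσ => ?_).trans_eq (by ring)
        · split_ifs
          · exact hv σ
          · exact zero_le
        · split_ifs at hσ with h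
          · refine (hQ σ hσ).2.step (D := ∅) (fun f hf => Or.inl hf) (fun f hf hf' => ?_)
              (Finset.empty_subset _)
            rw [← greatest_eq_none_iff.1 h]
            simp only [Finset.mem_union] at hf'
            exact Finset.mem_inter.2 ⟨hf, hf'.resolve_left (Finset.notMem_empty f)⟩
          · exact absurd rfl hσ

/-- If every flaw satisfies the local lemma condition `γ c * ∑_S ∏_{j ∈ S} ψ j ≤ r * ψ c`, where
`S` runs over the independent sets of neighbors of `c`, then the probability that the recursive
walk has a flaw left after `t` steps decays like `r ^ t`. -/
theorem recursiveWalk_toOuterMeasure_le [Fintype ι] {γ ψ : ι → ℝ≥0∞} {r : ℝ≥0∞}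
    (hsymm : ∀ a b, b ∈ Γ a → a ∈ Γ b) (hloop : ∀ a, a ∈ Γ a)
    (hcause : ∀ c σ τ, c ∈ U σ → ρ c σ τ ≠ 0 → ∀ f ∈ U τ, f ∈ U σ ∨ f ∈ Γ c)
    (hγ : ∀ c τ, ∑' σ, (open Classical in if c ∈ U σ then ρ c σ τ else 0) ≤ γ c)
    (hψ : ∀ c, γ c * indepSum Γ ψ (Γ c) ≤ r * ψ c) (θ : PMF Ω) (t : ℕ) :
    (recursiveWalk prio U Γ ρ θ t).toOuterMeasure {x | U x.1 ≠ ∅} ≤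
      (∑' _ : Ω, 1) * r ^ t * indepSum Γ ψ Finset.univ := by
  classical
  rw [recursiveWalk_toOuterMeasure_ne_empty]
  have := tsum_mul_survival_le (prio := prio) hsymm hloop hcause hγ hψ Finset.univ t [] θ 1
    (fun σ => θ.coe_le_one σ) (fun σ _ => by simp [Compatible])
  simpa [levelWeight] using this

end Walk

/-! ### Independent sets of flaws that meet a given set -/

section Meeting

open scoped ENNReal

variable {ι α : Type*}

open Classical in
lemma indepSum_insert_le (Γ : ι → Finset ι) (ψ : ι → ℝ≥0∞) (c : ι) (B : Finset ι) :
    indepSum Γ ψ (insert c B) ≤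
      indepSum Γ ψ B + ψ c * indepSum Γ ψ (B.filter fun b => b ∉ Γ c) := by
  by_cases hc : c ∈ B
  · rw [Finset.insert_eq_self.2 hc]
    exact le_self_add
  conv_lhs => rw [indepSum, Finset.sum_filter, Finset.sum_powerset_insert hc]
  rw [← Finset.sum_filter, ← Finset.sum_filter]
  refine add_le_add le_rfl ?_
  rw [indepSum, Finset.mul_sum]
  calc _ = ∑ S ∈ B.powerset.filter fun S : Finset ι =>
          ((insert c S : Finset ι) : Set ι).Pairwise fun a b => b ∉ Γ a, ψ c * ∏ j ∈ S, ψ j := by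
        refine Finset.sum_congr rfl fun S hS => ?_
        rw [Finset.prod_insert fun h => hc (Finset.mem_powerset.1 (Finset.mem_filter.1 hS).1 h)]
    _ ≤ _ := by
        apply Finset.sum_le_sum_of_subset
        intro S hS
        simp only [Finset.mem_filter, Finset.mem_powerset, Finset.coe_insert] at hS ⊢
        refine ⟨fun b hb => Finset.mem_filter.2 ⟨hS.1 hb, ?_⟩,
          hS.2.mono (Set.subset_insert _ _)⟩
        exact hS.2 (Set.mem_insert _ _) (Set.mem_insert_of_mem _ hb) fun h => hc (hS.1 (h ▸ hb))

open Classical in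
/-- An independent set contains at most one flaw of a clique `K`. -/
lemma indepSum_union_clique_le (Γ : ι → Finset ι) (ψ : ι → ℝ≥0∞) (B K : Finset ι)
    (hK : ∀ a ∈ K, ∀ b ∈ K, b ∈ Γ a) :
    indepSum Γ ψ (B ∪ K) ≤ (1 + ∑ c ∈ K, ψ c) * indepSum Γ ψ B := by
  induction K using Finset.induction_on with
  | empty => simp
  | insert c K hc ih =>
    rw [Finset.union_insert]
    refine (indepSum_insert_le Γ ψ c _).trans ?_
    have h1 := ih fun a ha b hb =>
      hK a (Finset.mem_insert_of_mem ha) b (Finset.mem_insert_of_mem hb)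
    have h2 : indepSum Γ ψ ((B ∪ K).filter fun b => b ∉ Γ c) ≤ indepSum Γ ψ B := by
      refine indepSum_mono Γ ψ fun b hb => ?_
      simp only [Finset.mem_filter, Finset.mem_union] at hb
      exact hb.1.resolve_right fun h =>
        hb.2 (hK c (Finset.mem_insert_self _ _) b (Finset.mem_insert_of_mem h))
    refine (add_le_add h1 (mul_le_mul_right h2 _)).trans_eq ?_
    rw [Finset.sum_insert hc]
    ring

open Classical in
/-- If flaws are sets that are neighbors when they intersect, then an independent set of flaws
that meet `A` is given by at most one flaw through each element of `A`. -/
lemma indepSum_le_one_add_pow {Γ : ι → Finset ι} {ψ : ι → ℝ≥0∞}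
    (supp : ι → Finset α) (hΓ : ∀ a b, b ∈ Γ a ↔ ∃ e, e ∈ supp a ∧ e ∈ supp b) {x : ℝ≥0∞}
    (hx : ∀ (e : α) (K : Finset ι), (∀ c ∈ K, e ∈ supp c) → ∑ c ∈ K, ψ c ≤ x) (A : Finset α)
    (B : Finset ι) (hB : ∀ c ∈ B, ∃ e ∈ A, e ∈ supp c) :
    indepSum Γ ψ B ≤ (1 + x) ^ A.card := by
  induction A using Finset.induction_on generalizing B with
  | empty =>
    have : B = ∅ := Finset.eq_empty_of_forall_notMem fun c hc => by
      obtain ⟨e, he, -⟩ := hB c hc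
      exact Finset.notMem_empty e he
    simp [this, indepSum_empty]
  | insert e A he ih =>
    have h1 : B ⊆ (B.filter fun c => ∃ f ∈ A, f ∈ supp c) ∪
        B.filter fun c => e ∈ supp c := by
      intro c hc
      obtain ⟨f, hf, hfc⟩ := hB c hc
      simp only [Finset.mem_union, Finset.mem_filter]
      rcases Finset.mem_insert.1 hf with rfl | hf
      · exact Or.inr ⟨hc, hfc⟩
      · exact Or.inl ⟨hc, f, hf, hfc⟩
    refine (indepSum_mono Γ ψ h1).trans ((indepSum_union_clique_le Γ ψ _ _ ?_).trans ?_)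
    · intro a ha b hb
      exact (hΓ a b).2 ⟨e, (Finset.mem_filter.1 ha).2, (Finset.mem_filter.1 hb).2⟩
    · rw [Finset.card_insert_of_notMem he, pow_succ']
      exact mul_le_mul' (add_le_add le_rfl (hx e _ fun c hc => (Finset.mem_filter.1 hc).2))
        (ih _ fun c hc => (Finset.mem_filter.1 hc).2)

end Meeting

/-! ### Counting the cycles through an edge -/

section Cycles

variable {V : Type*} {G : SimpleGraph V}

lemma card_of_mem_iff_edges {C : Finset G.edgeSet} {v w : V} {p : G.Walk v w}
    (hp : p.edges.Nodup) (hC : ∀ e : G.edgeSet, e ∈ C ↔ (e : Sym2 V) ∈ p.edges) :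
    C.card = p.length := by
  classical
  rw [← Finset.card_image_of_injective C Subtype.val_injective, ← p.length_edges,
    ← List.toFinset_card_of_nodup hp]
  congr 1
  ext e
  simp only [Finset.mem_image, List.mem_toFinset]
  constructor
  · rintro ⟨e, he, rfl⟩
    exact (hC e).1 he
  · intro he
    exact ⟨⟨e, p.edges_subset_edgeSet he⟩, (hC _).2 he, rfl⟩

/-- A cycle can be traversed starting with any of its edges, in either direction. -/
lemma IsCycleSet.exists_cons {C : Finset G.edgeSet} (hC : IsCycleSet G C) {u v : V}
    (h : G.Adj u v) (he : (⟨s(u, v), h⟩ : G.edgeSet) ∈ C) :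
    ∃ q : G.Walk v u, (SimpleGraph.Walk.cons h q).IsCycle ∧
      ∀ e : G.edgeSet, e ∈ C ↔ (e : Sym2 V) ∈ (SimpleGraph.Walk.cons h q).edges := by
  classical
  obtain ⟨w, p, hp, hpC⟩ := hC
  have he' : s(u, v) ∈ p.edges := (hpC _).1 he
  have hu : u ∈ p.support := p.fst_mem_support_of_mem_edges he'
  have key : ∀ r : G.Walk u u, r.IsCycle → r.snd = v →
      (∀ e : G.edgeSet, e ∈ C ↔ (e : Sym2 V) ∈ r.edges) →
      ∃ q : G.Walk v u, (SimpleGraph.Walk.cons h q).IsCycle ∧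
        ∀ e : G.edgeSet, e ∈ C ↔ (e : Sym2 V) ∈ (SimpleGraph.Walk.cons h q).edges := by
    intro r hr hs hrC
    cases r with
    | nil => exact absurd hr (by simp)
    | cons h' q =>
      rw [SimpleGraph.Walk.snd_cons] at hs
      subst hs
      exact ⟨q, hr, hrC⟩
  have hr : (p.rotate u hu).IsCycle := hp.rotate hu
  have hrC : ∀ e : G.edgeSet, e ∈ C ↔ (e : Sym2 V) ∈ (p.rotate u hu).edges := fun e =>
    (hpC e).trans (p.rotate_edges u hu).mem_iff.symm
  have hv : v ∈ (p.rotate u hu).toSubgraph.neighborSet u := by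
    rw [SimpleGraph.Subgraph.mem_neighborSet, ← SimpleGraph.Subgraph.mem_edgeSet,
      SimpleGraph.Walk.mem_edges_toSubgraph]
    exact (hrC _).1 he
  rw [hr.neighborSet_toSubgraph_endpoint] at hv
  rcases hv with hv | hv
  · exact key _ hr hv.symm hrC
  · refine key _ hr.reverse ?_ fun e => (hrC e).trans ?_
    · rw [SimpleGraph.Walk.snd_reverse]
      exact hv.symm
    · rw [SimpleGraph.Walk.edges_reverse, List.mem_reverse]

variable [Fintype V] [DecidableRel G.Adj]

open Classical in
/-- The continuations by `k` vertices of the non-backtracking walks that start with `a`, `b`. -/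
noncomputable def nonBacktracking (G : SimpleGraph V) [DecidableRel G.Adj] :
    ℕ → V → V → Finset (List V)
  | 0, _, _ => {[]}
  | k + 1, a, b => ((G.neighborFinset b).erase a).biUnion fun c =>
      (nonBacktracking G k b c).image (List.cons c)

lemma card_nonBacktracking_le (k : ℕ) {a b : V} (h : G.Adj a b) :
    (nonBacktracking G k a b).card ≤ (G.maxDegree - 1) ^ k := by
  classical
  induction k generalizing a b with
  | zero => simp [nonBacktracking]
  | succ k ih =>
    rw [nonBacktracking]
    refine Finset.card_biUnion_le.trans ?_
    have h1 : ∀ c ∈ (G.neighborFinset b).erase a,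
        ((nonBacktracking G k b c).image (List.cons c)).card ≤ (G.maxDegree - 1) ^ k := by
      intro c hc
      refine Finset.card_image_le.trans (ih ?_)
      simpa using Finset.mem_of_mem_erase hc
    refine (Finset.sum_le_card_nsmul _ _ _ h1).trans ?_
    rw [smul_eq_mul, pow_succ']
    gcongr
    rw [Finset.card_erase_of_mem (by simpa using h.symm), SimpleGraph.card_neighborFinset_eq_degree]
    exact Nat.sub_le_sub_right (G.degree_le_maxDegree b) 1

lemma exists_mem_nonBacktracking {a b u : V} (h : G.Adj a b) (q : G.Walk b u) (hq : q.length ≠ 0)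
    (hn : (SimpleGraph.Walk.cons h q).edges.Nodup) :
    ∃ l ∈ nonBacktracking G (q.length - 1) a b, q.support = b :: l ++ [u] := by
  classical
  induction q generalizing a with
  | nil => exact absurd rfl hq
  | @cons b c u h' q ih =>
    cases q with
    | nil => exact ⟨[], by simp [nonBacktracking]⟩
    | cons h'' q =>
      rw [SimpleGraph.Walk.edges_cons, List.nodup_cons] at hn
      obtain ⟨l, hl, hs⟩ := ih h' (by simp) hn.2
      refine ⟨c :: l, ?_, ?_⟩
      · simp only [SimpleGraph.Walk.length_cons, Nat.add_sub_cancel] at hl ⊢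
        rw [nonBacktracking, Finset.mem_biUnion]
        refine ⟨c, ?_, Finset.mem_image_of_mem _ hl⟩
        rw [Finset.mem_erase, SimpleGraph.mem_neighborFinset]
        refine ⟨?_, h'⟩
        rintro rfl
        apply hn.1
        simp [Sym2.eq_swap]
      · rw [SimpleGraph.Walk.support_cons, hs]
        rfl

open Classical in
/-- There are at most `(Δ - 1) ^ (m - 2)` cycles of length `m` through an edge: follow such a
cycle from the edge; its last vertex is prescribed. -/
lemma card_cycles_through_le (e : G.edgeSet) (m : ℕ) (𝒞 : Finset (Finset G.edgeSet))
    (h𝒞 : ∀ C ∈ 𝒞, IsCycleSet G C ∧ e ∈ C ∧ C.card = m) :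
    𝒞.card ≤ (G.maxDegree - 1) ^ (m - 2) := by
  obtain ⟨⟨u, v⟩, h⟩ := e
  change G.Adj u v at h
  have key : ∀ C ∈ 𝒞, ∃ l ∈ nonBacktracking G (m - 2) u v,
      ∀ e : G.edgeSet, e ∈ C ↔
        (e : Sym2 V) ∈ List.zipWith (s(·, ·)) (u :: v :: l ++ [u]) (v :: l ++ [u]) := by
    intro C hC
    obtain ⟨h1, h2, h3⟩ := h𝒞 C hC
    obtain ⟨q, hq, hqC⟩ := h1.exists_cons h h2
    have hlen := card_of_mem_iff_edges hq.edges_nodup hqC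
    have := hq.three_le_length
    rw [SimpleGraph.Walk.length_cons] at hlen this
    obtain ⟨l, hl, hs⟩ := exists_mem_nonBacktracking h q (by omega) hq.edges_nodup
    refine ⟨l, by rwa [show m - 2 = q.length - 1 by omega], fun e => (hqC e).trans ?_⟩
    rw [SimpleGraph.Walk.edges_eq_zipWith_support, SimpleGraph.Walk.support_cons, hs]
    rfl
  choose! f hf hf' using key
  refine (Finset.card_le_card_of_injOn f hf fun C hC C' hC' heq => ?_).trans
    (card_nonBacktracking_le (m - 2) h)
  ext e
  rw [hf' C hC, hf' C' hC', heq]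

end Cycles

/-! ### 4-available colors -/

section Available

variable {V : Type*} {G : SimpleGraph V} {P : Type*}

/-- Proper partial edge-colorings without bichromatic 4-cycles. -/
def IsGood (s : G.edgeSet → Option P) : Prop :=
  (∀ e f : G.edgeSet, G.lineGraph.Adj e f → ∀ c, s e = some c → s f ≠ some c) ∧
    ∀ C : Finset G.edgeSet, IsCycleSet G C → C.card = 4 → ¬ Bichromatic s C

lemma lineGraph_adj_of_ne {u v w : V} (h : G.Adj u v) (h' : G.Adj u w) (hne : v ≠ w) :
    G.lineGraph.Adj ⟨s(u, v), h⟩ ⟨s(u, w), h'⟩ := by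
  rw [SimpleGraph.lineGraph_adj_iff_exists]
  refine ⟨fun heq => hne ?_, u, by simp, by simp⟩
  exact Sym2.congr_right.1 (Subtype.ext_iff.1 heq)

lemma mk_swap {u v : V} (h : G.Adj u v) :
    (⟨s(u, v), h⟩ : G.edgeSet) = ⟨s(v, u), h.symm⟩ :=
  Subtype.ext Sym2.eq_swap

open Classical in
/-- The colors at the vertex `u` on edges that do not lead to `v`. -/
noncomputable def colorsAt [Fintype P] (s : G.edgeSet → Option P) (u v : V) : Finset P :=
  Finset.univ.filter fun c => ∃ (w : V) (h : G.Adj u w), w ≠ v ∧ s ⟨s(u, w), h⟩ = some c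

open Classical in
lemma card_colorsAt_le [Fintype V] [DecidableRel G.Adj] [Fintype P]
    (s : G.edgeSet → Option P) {u v : V} (h : G.Adj u v) :
    (colorsAt s u v).card ≤ G.maxDegree - 1 := by
  have h1 : (colorsAt s u v).image some ⊆ ((G.neighborFinset u).erase v).image
      fun w => if h : G.Adj u w then s ⟨s(u, w), h⟩ else none := by
    intro c hc
    obtain ⟨d, hd, rfl⟩ := Finset.mem_image.1 hc
    simp only [colorsAt, Finset.mem_filter, Finset.mem_univ, true_and] at hd
    obtain ⟨w, hw, hne, hs⟩ := hd
    refine Finset.mem_image.2 ⟨w, ?_, by simp [hw, hs]⟩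
    rw [Finset.mem_erase, SimpleGraph.mem_neighborFinset]
    exact ⟨hne, hw⟩
  rw [← Finset.card_image_of_injective _ (Option.some_injective P)]
  refine (Finset.card_le_card h1).trans (Finset.card_image_le.trans ?_)
  rw [Finset.card_erase_of_mem (by simpa using h), SimpleGraph.card_neighborFinset_eq_degree]
  exact Nat.sub_le_sub_right (G.degree_le_maxDegree u) 1

open Classical in
/-- If a color is 4-forbidden for an edge `uv`, then it appears at `u` or `v`, or on an edge `wx`
such that `vw` and `ux` have a common color. -/
lemma FourForbidden.cases [Fintype P] {s : G.edgeSet → Option P} (hs : IsGood s) {u v : V}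
    (h : G.Adj u v) {c : P} (hc : FourForbidden s ⟨s(u, v), h⟩ c) :
    c ∈ colorsAt s u v ∪ colorsAt s v u ∨
      ∃ (b : P) (w x : V) (hvw : G.Adj v w) (hux : G.Adj u x) (hwx : G.Adj w x),
        w ≠ u ∧ x ≠ v ∧ s ⟨s(v, w), hvw⟩ = some b ∧ s ⟨s(u, x), hux⟩ = some b ∧
          s ⟨s(w, x), hwx⟩ = some c := by
  by_cases hmem : c ∈ colorsAt s u v ∪ colorsAt s v u
  · exact Or.inl hmem
  refine Or.inr ?_
  simp only [Finset.mem_union, colorsAt, Finset.mem_filter, Finset.mem_univ, true_and,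
    not_or, not_exists, not_and] at hmem
  obtain ⟨hmu, hmv⟩ := hmem
  rcases hc with ⟨f, hadj, hf⟩ | ⟨C, hC, h4, heC, a, b, hab, hB⟩
  · exfalso
    obtain ⟨hne, x, hx, hxf⟩ := SimpleGraph.lineGraph_adj_iff_exists.1 hadj
    obtain ⟨f, hfe⟩ := f
    obtain ⟨y, rfl⟩ := Sym2.mem_iff_exists.1 hxf
    rcases Sym2.mem_iff.1 hx with rfl | rfl
    · exact hmu y hfe (fun h => hne (by subst h; rfl)) hf
    · refine hmv y hfe (fun h => hne ?_) hf
      subst h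
      exact mk_swap _
  · -- The 4-cycle is `u v w x`.
    obtain ⟨q, hq, hqC⟩ := hC.exists_cons h heC
    have hlen := card_of_mem_iff_edges hq.edges_nodup hqC
    have hnd := hq.edges_nodup
    rw [h4] at hlen
    cases q with
    | nil => simp at hlen
    | @cons _ w _ hvw q =>
    cases q with
    | nil => simp at hlen
    | @cons _ x _ hwx q =>
    cases q with
    | nil => simp at hlen
    | @cons _ y _ hxy q =>
    cases q with
    | cons _ q => simp at hlen
    | nil =>
    simp only [SimpleGraph.Walk.edges_cons, SimpleGraph.Walk.edges_nil, List.nodup_cons,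
      List.mem_cons, not_or] at hnd
    have hwu : w ≠ u := fun h => hnd.1.1 (by rw [h, Sym2.eq_swap])
    have hxv : x ≠ v := fun h => hnd.1.2.2.1 (by rw [h, Sym2.eq_swap])
    have h01 := hnd.1.1
    have h02 := hnd.1.2.1
    have h03 := hnd.1.2.2.1
    have h12 := hnd.2.1.1
    have hval : ∀ f : G.edgeSet, f ∈ C →
        Function.update s ⟨s(u, v), h⟩ (some c) f = some a ∨
        Function.update s ⟨s(u, v), h⟩ (some c) f = some b := by
      intro f hf
      have : Function.update s ⟨s(u, v), h⟩ (some c) f ∈ ({some a, some b} : Set (Option P)) :=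
        hB ▸ ⟨f, hf, rfl⟩
      simpa using this
    have hval' : ∀ (f : Sym2 V) (hf : f ∈ G.edgeSet), (⟨f, hf⟩ : G.edgeSet) ∈ C → s(u, v) ≠ f →
        s ⟨f, hf⟩ = some a ∨ s ⟨f, hf⟩ = some b := by
      intro f hf hfC hne
      have := hval ⟨f, hf⟩ hfC
      rwa [Function.update_of_ne (fun h => hne (Subtype.ext_iff.1 h).symm)] at this
    have e0 := hval ⟨s(u, v), h⟩ heC
    rw [Function.update_self] at e0
    have e1 := hval' s(v, w) hvw ((hqC _).2 (by simp)) h01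
    have e2 := hval' s(w, x) hwx ((hqC _).2 (by simp)) h02
    have e3 := hval' s(x, u) hxy ((hqC _).2 (by simp)) h03
    have n1 := hmv w hvw hwu
    have n3 := hmu x hxy.symm hxv
    rw [← mk_swap hxy] at n3
    have n12 : ∀ d, s ⟨s(v, w), hvw⟩ = some d → s ⟨s(w, x), hwx⟩ ≠ some d := by
      refine hs.1 _ _ (SimpleGraph.lineGraph_adj_iff_exists.2 ⟨?_, w, by simp, by simp⟩)
      exact fun h => h12 (Subtype.ext_iff.1 h)
    -- `c` is one of the two colors, and the neighbors `vw`, `ux` of the edge have the other one.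
    rcases e0 with e0 | e0 <;> obtain rfl := Option.some.inj e0
    · have e1 := e1.resolve_left n1
      exact ⟨b, w, x, hvw, hxy.symm, hwx, hwu, hxv, e1,
        by rw [← mk_swap hxy]; exact e3.resolve_left n3, e2.resolve_right (n12 _ e1)⟩
    · have e1 := e1.resolve_right n1
      exact ⟨a, w, x, hvw, hxy.symm, hwx, hwu, hxv, e1,
        by rw [← mk_swap hxy]; exact e3.resolve_right n3, e2.resolve_left (n12 _ e1)⟩

open Classical in
/-- At most `2(Δ - 1)` colors are 4-forbidden for an edge `uv`: a color that is forbidden because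
of a 4-cycle is determined by a color that appears both at `u` and at `v`, and such colors are
counted only once among those that appear at `u` or `v`. -/
lemma card_fourForbidden_le [Fintype V] [DecidableRel G.Adj] [Fintype P]
    {s : G.edgeSet → Option P} (hs : IsGood s) (e : G.edgeSet) :
    (Finset.univ.filter fun c => FourForbidden s e c).card ≤ 2 * (G.maxDegree - 1) := by
  obtain ⟨⟨u, v⟩, h⟩ := e
  change G.Adj u v at h
  set A := colorsAt s u v
  set B := colorsAt s v u
  have hsub : ((Finset.univ.filter fun c => FourForbidden s ⟨s(u, v), h⟩ c) \ (A ∪ B)).card ≤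
      (A ∩ B).card := by
    have key : ∀ c ∈ (Finset.univ.filter fun c => FourForbidden s ⟨s(u, v), h⟩ c) \ (A ∪ B),
        ∃ b : P, ∃ (w x : V) (hvw : G.Adj v w) (hux : G.Adj u x) (hwx : G.Adj w x),
        w ≠ u ∧ x ≠ v ∧ s ⟨s(v, w), hvw⟩ = some b ∧ s ⟨s(u, x), hux⟩ = some b ∧
          s ⟨s(w, x), hwx⟩ = some c := by
      intro c hc
      simp only [Finset.mem_sdiff, Finset.mem_filter, Finset.mem_univ, true_and] at hc
      exact (hc.1.cases hs h).resolve_left hc.2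
    choose! g hg using key
    refine Finset.card_le_card_of_injOn g (fun c hc => ?_) fun c hc c' hc' heq => ?_
    · obtain ⟨w, x, hvw, hux, -, hwu, hxv, h1, h2, -⟩ := hg c hc
      simp only [A, B, colorsAt, Finset.coe_inter, Finset.coe_filter, Finset.mem_univ, true_and]
      exact ⟨⟨x, hux, hxv, h2⟩, ⟨w, hvw, hwu, h1⟩⟩
    · obtain ⟨w, x, hvw, hux, hwx, -, -, h1, h2, h3⟩ := hg c hc
      obtain ⟨w', x', hvw', hux', hwx', -, -, h1', h2', h3'⟩ := hg c' hc'
      rw [heq] at h1 h2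
      obtain rfl : w = w' := by
        by_contra hne
        exact hs.1 _ _ (lineGraph_adj_of_ne hvw hvw' hne) _ h1 h1'
      obtain rfl : x = x' := by
        by_contra hne
        exact hs.1 _ _ (lineGraph_adj_of_ne hux hux' hne) _ h2 h2'
      exact Option.some.inj (h3.symm.trans h3')
  have h1 := Finset.card_le_card_sdiff_add_card
    (s := Finset.univ.filter fun c => FourForbidden s ⟨s(u, v), h⟩ c) (t := A ∪ B)
  have h2 := Finset.card_union_add_card_inter A B
  have h3 : A.card ≤ _ := card_colorsAt_le s h
  have h4 : B.card ≤ _ := card_colorsAt_le s h.symm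
  change (Finset.univ.filter fun c => FourForbidden s ⟨s(u, v), h⟩ c).card ≤ _
  omega

lemma le_card_fourAvailable [Fintype V] [DecidableRel G.Adj] [Fintype P]
    {s : G.edgeSet → Option P} (hs : IsGood s) (e : G.edgeSet) :
    Fintype.card P - 2 * (G.maxDegree - 1) ≤ (fourAvailable s e).card := by
  classical
  have h1 := card_fourForbidden_le hs e
  have h2 := Finset.card_filter_add_card_filter_not (s := (Finset.univ : Finset P))
    (fun c => FourForbidden s e c)
  rw [Finset.card_univ] at h2
  rw [fourAvailable]
  omega

/-! ### Recoloring -/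

lemma Bichromatic.congr {s s' : G.edgeSet → Option P} {C : Finset G.edgeSet}
    (h : Bichromatic s C) (hs : ∀ e ∈ C, s e = s' e) : Bichromatic s' C := by
  obtain ⟨a, b, hab, hB⟩ := h
  refine ⟨a, b, hab, ?_⟩
  rw [← hB]
  exact (Set.image_congr hs).symm

open Classical in
lemma IsGood.update [Fintype P] {s : G.edgeSet → Option P} (hs : IsGood s) {e : G.edgeSet}
    {c : P} (hc : c ∈ fourAvailable s e) : IsGood (Function.update s e (some c)) := by
  simp only [fourAvailable, Finset.mem_filter, Finset.mem_univ, true_and, FourForbidden,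
    not_or, not_exists, not_and] at hc
  refine ⟨fun f g hfg d hf hg => ?_, fun C hC h4 hB => ?_⟩
  · by_cases hfe : f = e
    · subst hfe
      rw [Function.update_self] at hf
      rw [Function.update_of_ne hfg.ne.symm] at hg
      exact hc.1 g hfg (hg.trans hf.symm)
    · by_cases hge : g = e
      · subst hge
        rw [Function.update_self] at hg
        rw [Function.update_of_ne hfe] at hf
        exact hc.1 f hfg.symm (hf.trans hg.symm)
      · rw [Function.update_of_ne hfe] at hf
        rw [Function.update_of_ne hge] at hg
        exact hs.1 f g hfg d hf hg
  · by_cases he : e ∈ C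
    · exact hc.2 C hC h4 he hB
    · exact hs.2 C hC h4 (hB.congr fun f hf =>
        Function.update_of_ne (by rintro rfl; exact he hf) _ _)

lemma IsGood.uncolor {s : G.edgeSet → Option P} (hs : IsGood s) (L : List G.edgeSet) :
    IsGood (uncolor L s) := by
  classical
  have hsome : ∀ e c, AEC.uncolor L s e = some c → s e = some c := by
    intro e c h
    rw [AEC.uncolor] at h
    split_ifs at h
    exact h
  refine ⟨fun e f hef c he hf => hs.1 e f hef c (hsome e c he) (hsome f c hf),
    fun C hC h4 hB => hs.2 C hC h4 (hB.congr fun e he => ?_)⟩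
  obtain ⟨a, b, -, hB⟩ := hB
  have : AEC.uncolor L s e ∈ ({some a, some b} : Set (Option P)) := hB ▸ ⟨e, he, rfl⟩
  rcases this with h | h
  · rw [h, hsome e a h]
  · rw [h, hsome e b h]

lemma isGood_toPartial (σ : State G P) : IsGood (toPartial σ.1) :=
  ⟨fun e f hef _ he hf => σ.2.1 e f hef (Option.some.inj (he.trans hf.symm)), σ.2.2⟩

lemma IsGood.exists_state {s : G.edgeSet → Option P} (hs : IsGood s)
    (htot : ∀ e, ∃ c, s e = some c) : ∃ τ : State G P, toPartial τ.1 = s := by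
  choose σ hσ using htot
  have h : toPartial σ = s := funext fun e => (hσ e).symm
  subst h
  exact ⟨⟨σ, fun e f hef h => hs.1 e f hef (σ e) rfl (congrArg some h.symm), hs.2⟩, rfl⟩

lemma CanRecolor.isGood [Fintype P] {L : List G.edgeSet} {s s' : G.edgeSet → Option P}
    (hs : IsGood s) (h : CanRecolor L s s') : IsGood s' := by
  induction L generalizing s with
  | nil =>
    rw [CanRecolor] at h
    exact h ▸ hs
  | cons e L ih =>
    obtain ⟨c, hc, h⟩ := h
    exact ih (hs.update hc) h

open Classical in
lemma CanRecolor.eq_of_notMem [Fintype P] {L : List G.edgeSet} {s s' : G.edgeSet → Option P}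
    (h : CanRecolor L s s') {e : G.edgeSet} (he : e ∉ L) : s' e = s e := by
  induction L generalizing s with
  | nil =>
    rw [CanRecolor] at h
    rw [h]
  | cons f L ih =>
    obtain ⟨c, hc, h⟩ := h
    rw [List.mem_cons, not_or] at he
    rw [ih h he.2, Function.update_of_ne he.1]

open Classical in
lemma CanRecolor.exists_eq_some [Fintype P] {L : List G.edgeSet} {s s' : G.edgeSet → Option P}
    (h : CanRecolor L s s') {e : G.edgeSet} (he : e ∈ L ∨ ∃ c, s e = some c) :
    ∃ c, s' e = some c := by
  induction L generalizing s with
  | nil =>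
    rw [CanRecolor] at h
    simpa [h] using he
  | cons f L ih =>
    obtain ⟨c, hc, h⟩ := h
    refine ih h ?_
    by_cases hef : e = f
    · subst hef
      exact Or.inr ⟨c, Function.update_self ..⟩
    · rw [Function.update_of_ne hef]
      simpa [hef] using he

/-- The greedy coloring is a state, if every edge always has an available color. -/
lemma exists_state_greedyColoring [Fintype P] [LinearOrder P]
    (hm : ∀ s : G.edgeSet → Option P, IsGood s → ∀ e, (fourAvailable s e).Nonempty)
    (order : List G.edgeSet) (hall : ∀ e, e ∈ order) :
    ∃ σ : State G P, toPartial σ.1 = greedyColoring order := by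
  classical
  suffices h : ∀ s : G.edgeSet → Option P, IsGood s →
      CanRecolor order s (order.foldl
        (fun s e => Function.update s e
          (if h : (fourAvailable s e).Nonempty then some ((fourAvailable s e).max' h)
            else none)) s) by
    have h0 : IsGood (fun _ => none : G.edgeSet → Option P) := by
      refine ⟨fun e f _ c h => by simp at h, ?_⟩
      rintro C - - ⟨a, b, -, hB⟩
      have : some a ∈ (fun _ => none : G.edgeSet → Option P) '' (C : Set G.edgeSet) := by
        rw [hB]
        simp
      obtain ⟨e, -, he⟩ := this
      simp at he
    have hcan : CanRecolor order (fun _ => none : G.edgeSet → Option P)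
        (greedyColoring order) := h _ h0
    exact (hcan.isGood h0).exists_state fun e => hcan.exists_eq_some (Or.inl (hall e))
  clear hall
  induction order with
  | nil =>
    intro s _
    rw [CanRecolor]
    rfl
  | cons e L ih =>
    intro s hs
    rw [List.foldl_cons, dif_pos (hm s hs e)]
    exact ⟨_, Finset.max'_mem _ _, ih _ (hs.update (Finset.max'_mem _ _))⟩

variable [Fintype V] [Fintype P]

open Classical in
lemma pow_le_ncard_canRecolor {m : ℕ}
    (hm : ∀ s : G.edgeSet → Option P, IsGood s → ∀ e, m ≤ (fourAvailable s e).card)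
    {L : List G.edgeSet} (hL : L.Nodup) {s : G.edgeSet → Option P} (hs : IsGood s) :
    m ^ L.length ≤ {s' | CanRecolor L s s'}.ncard := by
  induction L generalizing s with
  | nil => simp [CanRecolor]
  | cons e L ih =>
    rw [List.nodup_cons] at hL
    let S : P → Finset (G.edgeSet → Option P) := fun c =>
      (Set.toFinite {s' | CanRecolor L (Function.update s e (some c)) s'}).toFinset
    have hS : {s' | CanRecolor (e :: L) s s'} = ((fourAvailable s e).biUnion S : Set _) := by
      ext s'
      simp [S, CanRecolor]
    rw [hS, Set.ncard_coe_finset, Finset.card_biUnion]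
    · rw [List.length_cons, pow_succ']
      refine (Nat.mul_le_mul_right _ (hm s hs e)).trans ?_
      rw [← smul_eq_mul]
      refine Finset.card_nsmul_le_sum _ _ _ fun c hc => ?_
      rw [← Set.ncard_eq_toFinset_card]
      exact ih hL.2 (hs.update hc)
    · intro c _ c' _ hne
      rw [Function.onFun, Finset.disjoint_left]
      intro s' h h'
      simp only [S, Set.Finite.mem_toFinset, Set.mem_ofPred_eq] at h h'
      have h1 := h.eq_of_notMem hL.1
      rw [h'.eq_of_notMem hL.1, Function.update_self, Function.update_self] at h1
      exact hne (Option.some.inj h1).symm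

lemma pow_le_card_actions {m : ℕ}
    (hm : ∀ s : G.edgeSet → Option P, IsGood s → ∀ e, m ≤ (fourAvailable s e).card)
    {L : List G.edgeSet} (hL : L.Nodup) (σ : State G P) :
    m ^ (L.length - 2) ≤ (actions L σ).card := by
  classical
  have hg := (isGood_toPartial σ).uncolor (L.drop 2)
  have h1 := pow_le_ncard_canRecolor hm (hL.sublist (List.drop_sublist 2 L)) hg
  rw [List.length_drop] at h1
  refine h1.trans ?_
  rw [← Set.ncard_coe_finset]
  refine (Set.ncard_le_ncard (t := (fun τ : State G P => toPartial τ.1) '' (actions L σ : Set _))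
    (fun s' hs' => ?_) (Set.toFinite _)).trans (Set.ncard_image_le (Set.toFinite _))
  have hs'' : CanRecolor (L.drop 2) (uncolor (L.drop 2) (toPartial σ.1)) s' := hs'
  obtain ⟨τ, hτ⟩ := (hs''.isGood hg).exists_state fun e => hs''.exists_eq_some (by
    by_cases he : e ∈ L.drop 2
    · exact Or.inl he
    · exact Or.inr ⟨σ.1 e, by rw [uncolor, if_neg he]; rfl⟩)
  refine ⟨τ, ?_, hτ⟩
  simp only [actions, Set.Finite.coe_toFinset, Set.mem_ofPred_eq]
  rwa [hτ]

lemma eq_of_mem_actions {L : List G.edgeSet} {σ τ : State G P} (h : τ ∈ actions L σ)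
    {e : G.edgeSet} (he : e ∉ L.drop 2) : τ.1 e = σ.1 e := by
  simp only [actions, Set.Finite.mem_toFinset, Set.mem_ofPred_eq] at h
  have := h.eq_of_notMem he
  rw [uncolor, if_neg he] at this
  exact Option.some.inj this

end Available

/-! ### Bichromatic cycles -/

section Alternation

variable {V : Type*} {G : SimpleGraph V} {P : Type*}

lemma getElem_eq_getVert {v : V} {p : G.Walk v v} {L : List G.edgeSet}
    (hL : L.map Subtype.val = p.edges) (j : ℕ) (hj : j < L.length) :
    (L[j] : Sym2 V) = s(p.getVert j, p.getVert (j + 1)) := by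
  have hlen : L.length = p.edges.length := by rw [← hL, List.length_map]
  rw [← SimpleGraph.Walk.getElem_edges (hlen ▸ hj)]
  simp only [← hL, List.getElem_map]

lemma lineGraph_adj_getElem_succ {v : V} {p : G.Walk v v} (hp : p.IsCycle)
    {L : List G.edgeSet} (hL : L.map Subtype.val = p.edges) (i : ℕ)
    (hi : i + 1 < L.length) : G.lineGraph.Adj L[i] L[i + 1] := by
  have hnd : L.Nodup := List.Nodup.of_map _ (hL ▸ hp.edges_nodup)
  refine SimpleGraph.lineGraph_adj_iff_exists.2 ⟨fun h => ?_, p.getVert (i + 1), ?_, ?_⟩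
  · have := (List.Nodup.getElem_inj_iff hnd).1 h
    omega
  · rw [getElem_eq_getVert hL i (by omega)]
    simp
  · rw [getElem_eq_getVert hL (i + 1) hi]
    simp

lemma lineGraph_adj_getElem_last {v : V} {p : G.Walk v v} (hp : p.IsCycle)
    {L : List G.edgeSet} (hL : L.map Subtype.val = p.edges) (i : ℕ)
    (hi : i + 1 = L.length) : G.lineGraph.Adj L[0] L[i] := by
  have hlen : L.length = p.length := by rw [← p.length_edges, ← hL, List.length_map]
  have hnd : L.Nodup := List.Nodup.of_map _ (hL ▸ hp.edges_nodup)
  have h3 := hp.three_le_length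
  refine SimpleGraph.lineGraph_adj_iff_exists.2 ⟨fun h => ?_, v, ?_, ?_⟩
  · have := (List.Nodup.getElem_inj_iff hnd).1 h
    omega
  · rw [getElem_eq_getVert hL 0 (by omega)]
    simp
  · rw [getElem_eq_getVert hL i (by omega), hi, hlen, p.getVert_length]
    simp

/-- The colors of a bichromatic cycle alternate in a proper coloring. -/
lemma Bichromatic.getElem_add_two {σ : G.edgeSet → P} (hσ : IsProper σ) {C : Finset G.edgeSet}
    (hB : Bichromatic (toPartial σ) C) {v : V} {p : G.Walk v v} (hp : p.IsCycle)
    {L : List G.edgeSet} (hL : L.map Subtype.val = p.edges)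
    (hLC : ∀ e, e ∈ L ↔ e ∈ C) (i : ℕ) (hi : i + 2 < L.length) : σ L[i + 2] = σ L[i] := by
  obtain ⟨a, b, -, hB⟩ := hB
  have hval : ∀ (j : ℕ) (hj : j < L.length), σ L[j] = a ∨ σ L[j] = b := by
    intro j hj
    have : toPartial σ L[j] ∈ ({some a, some b} : Set (Option P)) :=
      hB ▸ ⟨L[j], (hLC _).1 (List.getElem_mem hj), rfl⟩
    simpa [toPartial] using this
  have h1 := hσ _ _ (lineGraph_adj_getElem_succ hp hL i (by omega))
  have h2 := hσ _ _ (lineGraph_adj_getElem_succ hp hL (i + 1) (by omega))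
  have e0 := hval i (by omega)
  have e1 := hval (i + 1) (by omega)
  have e2 := hval (i + 2) hi
  rcases e0 with e0 | e0 <;> rcases e1 with e1 | e1 <;> rcases e2 with e2 | e2 <;>
    simp_all

/-- An odd cycle cannot be bichromatic in a proper coloring. -/
lemma Bichromatic.even_card {σ : G.edgeSet → P} (hσ : IsProper σ) {C : Finset G.edgeSet}
    (hC : IsCycleSet G C) (hB : Bichromatic (toPartial σ) C) : Even C.card := by
  obtain ⟨v, p, hp, hpC⟩ := hC
  obtain ⟨L, hL⟩ : ∃ L : List G.edgeSet, L.map Subtype.val = p.edges := by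
    refine ⟨p.edges.attach.map fun e => ⟨e.1, p.edges_subset_edgeSet e.2⟩, ?_⟩
    rw [List.map_map]
    exact List.attach_map_subtype_val _
  have hLC : ∀ e, e ∈ L ↔ e ∈ C := by
    intro e
    rw [hpC, ← hL, List.mem_map]
    exact ⟨fun h => ⟨e, h, rfl⟩, fun ⟨f, hf, hfe⟩ => Subtype.ext hfe ▸ hf⟩
  have hlen : L.length = C.card := by
    rw [card_of_mem_iff_edges hp.edges_nodup hpC, ← p.length_edges, ← hL, List.length_map]
  rw [← hlen]
  by_contra hodd
  rw [Nat.not_even_iff_odd] at hodd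
  obtain ⟨k, hk⟩ := hodd
  have halt : ∀ (j : ℕ) (hj : 2 * j < L.length), σ L[2 * j] = σ L[0] := by
    intro j
    induction j with
    | zero => intro _; rfl
    | succ j ih =>
      intro hj
      rw [← ih (by omega)]
      exact hB.getElem_add_two hσ hp hL hLC (2 * j) hj
  exact hσ _ _ (lineGraph_adj_getElem_last hp hL (2 * k) (by omega)) (halt k (by omega)).symm

/-- The walk along a traversal. In `IsTraversal` the list of edges is coerced to a list of unordered
pairs by a bind in the list monad, which is a `map`. -/
lemma IsTraversal.exists_walk {C : EvenCycle G} {L : List G.edgeSet} (h : IsTraversal C L) :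
    ∃ (v : V) (p : G.Walk v v), p.IsCycle ∧ L.map Subtype.val = p.edges := by
  obtain ⟨-, v, p, hp, hL⟩ := h
  refine ⟨v, p, hp, ?_⟩
  rw [← hL]
  simp

lemma IsTraversal.nodup {C : EvenCycle G} {L : List G.edgeSet} (h : IsTraversal C L) :
    L.Nodup := by
  obtain ⟨v, p, hp, hL⟩ := h.exists_walk
  exact List.Nodup.of_map _ (hL ▸ hp.edges_nodup)

lemma IsTraversal.length_eq {C : EvenCycle G} {L : List G.edgeSet} (h : IsTraversal C L) :
    L.length = C.1.card := by
  classical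
  rw [← List.toFinset_card_of_nodup h.nodup]
  congr 1
  ext e
  rw [List.mem_toFinset, h.1]

variable [Fintype V]

lemma mem_presentFlaws {σ : State G P} {C : EvenCycle G} :
    C ∈ presentFlaws σ ↔ Bichromatic (toPartial σ.1) C.1 := by
  simp [presentFlaws]

lemma mem_cycleNbhd {C C' : EvenCycle G} :
    C' ∈ cycleNbhd C ↔ ∃ e, e ∈ C.1 ∧ e ∈ C'.1 := by
  simp [cycleNbhd]

lemma isAcyclicColoring_of_presentFlaws_eq_empty {σ : State G P} (h : presentFlaws σ = ∅) :
    IsAcyclicColoring σ.1 := by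
  refine ⟨σ.2.1, fun C hC hB => ?_⟩
  have heven := hB.even_card σ.2.1 hC
  have h3 : 3 ≤ C.card := by
    obtain ⟨v, p, hp, hpC⟩ := hC
    rw [card_of_mem_iff_edges hp.edges_nodup hpC]
    exact hp.three_le_length
  have h4 : C.card ≠ 4 := fun h4 => σ.2.2 C hC h4 hB
  have h6 : 6 ≤ C.card := by
    obtain ⟨k, hk⟩ := heven
    omega
  have : (⟨C, hC, heven, h6⟩ : EvenCycle G) ∈ presentFlaws σ := mem_presentFlaws.2 hB
  exact Finset.notMem_empty _ (h ▸ this)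

variable [Fintype P]

/-- The state before a recoloring is determined by the recolored cycle and the state after it:
the two edges that keep their colors show the colors of the bichromatic cycle. -/
lemma eq_of_mem_actions_of_mem_presentFlaws {C : EvenCycle G} {L : List G.edgeSet}
    (hL : IsTraversal C L) {σ σ' τ : State G P} (hσ : C ∈ presentFlaws σ)
    (hσ' : C ∈ presentFlaws σ') (hτ : τ ∈ actions L σ) (hτ' : τ ∈ actions L σ') : σ = σ' := by
  have hoff : ∀ e, e ∉ L.drop 2 → σ.1 e = σ'.1 e := fun e he =>
    (eq_of_mem_actions hτ he).symm.trans (eq_of_mem_actions hτ' he)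
  have hnd := hL.nodup
  have hLC := hL.1
  obtain ⟨v, p, hp, hLp⟩ := hL.exists_walk
  have hon : ∀ (i : ℕ) (hi : i < L.length), σ.1 L[i] = σ'.1 L[i] := by
    intro i
    induction i using Nat.strong_induction_on with
    | _ i ih =>
      intro hi
      -- The first two edges of the traversal keep their colors.
      by_cases h2 : i < 2
      · refine hoff _ fun hmem => ?_
        obtain ⟨j, hj, hij⟩ := List.getElem_of_mem hmem
        rw [List.getElem_drop] at hij
        have := (List.Nodup.getElem_inj_iff hnd).1 hij
        omega
      · obtain ⟨j, rfl⟩ : ∃ j, i = j + 2 := ⟨i - 2, by omega⟩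
        rw [(mem_presentFlaws.1 hσ).getElem_add_two σ.2.1 hp hLp hLC j hi,
          (mem_presentFlaws.1 hσ').getElem_add_two σ'.2.1 hp hLp hLC j hi]
        exact ih j (by omega) (by omega)
  refine Subtype.ext (funext fun e => ?_)
  by_cases he : e ∈ L.drop 2
  · obtain ⟨i, hi, rfl⟩ := List.getElem_of_mem (List.mem_of_mem_drop he)
    exact hon i hi
  · exact hoff e he

/-- Recoloring a cycle only affects cycles that share an edge with it. -/
lemma mem_presentFlaws_or_mem_cycleNbhd {C : EvenCycle G} {L : List G.edgeSet}
    (hL : IsTraversal C L) {σ τ : State G P} (hτ : τ ∈ actions L σ) {F : EvenCycle G}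
    (hF : F ∈ presentFlaws τ) : F ∈ presentFlaws σ ∨ F ∈ cycleNbhd C := by
  by_cases h : F ∈ cycleNbhd C
  · exact Or.inr h
  refine Or.inl (mem_presentFlaws.2 ((mem_presentFlaws.1 hF).congr fun e he => ?_))
  refine congrArg some (eq_of_mem_actions hτ fun hmem => h ?_)
  exact mem_cycleNbhd.2 ⟨e, (hL.1 e).1 (List.mem_of_mem_drop hmem), he⟩

end Alternation

/-! ### The weight of the cycles through an edge -/

section Numbers

open scoped ENNReal

variable {V : Type*} [Fintype V] {G : SimpleGraph V} [DecidableRel G.Adj]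

open Classical in
/-- The cycles through an edge, weighted by `(β / (Δ - 1)) ^ (m - 2)` for length `m`, have total
weight at most `β ^ 4 + β ^ 6 + ⋯`. -/
lemma sum_weight_through_le (hΔ : 2 ≤ G.maxDegree) {β : ℝ}
    (h0 : 0 ≤ β) (h1 : β < 1) (e : G.edgeSet) (S : Finset (EvenCycle G))
    (hS : ∀ C ∈ S, e ∈ C.1) :
    ∑ C ∈ S, (β / ((G.maxDegree : ℝ) - 1)) ^ (C.1.card - 2) ≤ β ^ 4 / (1 - β ^ 2) := by
  set D : ℝ := (G.maxDegree : ℝ) - 1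
  have hD : 0 < D := by
    have : (2 : ℝ) ≤ G.maxDegree := by exact_mod_cast hΔ
    simp only [D]
    linarith
  have hDcast : ((G.maxDegree - 1 : ℕ) : ℝ) = D := by
    rw [Nat.cast_sub (by omega), Nat.cast_one]
  -- A cycle of length `2 * k + 6` has index `k`.
  let idx : EvenCycle G → ℕ := fun C => (C.1.card - 6) / 2
  have hidx : ∀ C : EvenCycle G, C.1.card = 2 * idx C + 6 := by
    intro C
    obtain ⟨k, hk⟩ := C.2.2.1
    have := C.2.2.2
    simp only [idx]
    omega
  have hinj : Function.Injective fun C : EvenCycle G => C.1 := fun _ _ h => Subtype.ext h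
  have hcard : ∀ k, ((S.filter fun C => idx C = k).card : ℝ) ≤ D ^ (2 * k + 4) := by
    intro k
    have := card_cycles_through_le e (2 * k + 6)
      ((S.filter fun C => idx C = k).image fun C : EvenCycle G => C.1) (by
        intro C' hC'
        obtain ⟨C, hC, rfl⟩ := Finset.mem_image.1 hC'
        rw [Finset.mem_filter] at hC
        exact ⟨C.2.1, hS C hC.1, (hidx C).trans (by rw [hC.2])⟩)
    rw [Finset.card_image_of_injective _ hinj] at this
    rw [← hDcast]
    exact_mod_cast this
  have hmaps : ∀ C ∈ S, idx C ∈ S.image idx := fun C hC => Finset.mem_image_of_mem _ hC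
  rw [← Finset.sum_fiberwise_of_maps_to hmaps]
  have hβ2 : β ^ 2 < 1 := by nlinarith
  calc _ ≤ ∑ k ∈ S.image idx, β ^ 4 * (β ^ 2) ^ k := by
        refine Finset.sum_le_sum fun k _ => ?_
        calc _ = ∑ C ∈ S.filter fun C => idx C = k, (β / D) ^ (2 * k + 4) := by
              refine Finset.sum_congr rfl fun C hC => ?_
              rw [hidx C, (Finset.mem_filter.1 hC).2]
              rfl
          _ = (S.filter fun C => idx C = k).card * (β / D) ^ (2 * k + 4) := by
              rw [Finset.sum_const, nsmul_eq_mul]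
          _ ≤ D ^ (2 * k + 4) * (β / D) ^ (2 * k + 4) :=
              mul_le_mul_of_nonneg_right (hcard k) (by positivity)
          _ = β ^ 4 * (β ^ 2) ^ k := by
              rw [← mul_pow, mul_div_cancel₀ _ hD.ne', pow_add, pow_mul, mul_comm]
    _ ≤ ∑' k, β ^ 4 * (β ^ 2) ^ k :=
        ((summable_geometric_of_lt_one (by positivity) hβ2).mul_left _).sum_le_tsum _
          fun k _ => by positivity
    _ = β ^ 4 / (1 - β ^ 2) := by
        rw [tsum_mul_left, tsum_geometric_of_lt_one (by positivity) hβ2, div_eq_mul_inv]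

end Numbers

/-! ### The charges of the cycles and the local lemma condition -/

section Charges

open scoped ENNReal

lemma tsum_le_of_subsingleton_support {Ω : Type*} {f : Ω → ℝ≥0∞} {a : ℝ≥0∞}
    (h : ∀ σ σ', f σ ≠ 0 → f σ' ≠ 0 → σ = σ') (ha : ∀ σ, f σ ≤ a) : ∑' σ, f σ ≤ a := by
  by_cases h0 : ∃ σ, f σ ≠ 0
  · obtain ⟨σ, hσ⟩ := h0
    rw [tsum_eq_single σ fun σ' hne => by_contra fun h' => hne (h σ' σ h' hσ)]
    exact ha σ
  · push Not at h0
    simp [h0]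

variable {V : Type*} [Fintype V] {G : SimpleGraph V} {P : Type*} [Fintype P]

lemma transition_eq {m : ℕ} (hm0 : 0 < m)
    (hm : ∀ s : G.edgeSet → Option P, IsGood s → ∀ e, m ≤ (fourAvailable s e).card)
    {L : List G.edgeSet} (hL : L.Nodup) (σ : State G P) :
    ∃ h : (actions L σ).Nonempty, transition L σ = PMF.uniformOfFinset (actions L σ) h := by
  have h : (actions L σ).Nonempty :=
    Finset.card_pos.1 ((pow_pos hm0 _).trans_le (pow_le_card_actions hm hL σ))
  exact ⟨h, by rw [transition, dif_pos h]⟩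

lemma mem_actions_of_transition_ne_zero {m : ℕ} (hm0 : 0 < m)
    (hm : ∀ s : G.edgeSet → Option P, IsGood s → ∀ e, m ≤ (fourAvailable s e).card)
    {L : List G.edgeSet} (hL : L.Nodup) {σ τ : State G P} (h : transition L σ τ ≠ 0) :
    τ ∈ actions L σ := by
  obtain ⟨h', heq⟩ := transition_eq hm0 hm hL σ
  rw [heq] at h
  by_contra hτ
  exact h (PMF.uniformOfFinset_apply_of_notMem h' hτ)

open Classical in
/-- The charge of a cycle: the probabilities of the transitions into a fixed state that recolor
the cycle sum to at most `m⁻¹` for each of the recolored edges, since there is at most one such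
transition. -/
lemma tsum_transition_le {m : ℕ} (hm0 : 0 < m)
    (hm : ∀ s : G.edgeSet → Option P, IsGood s → ∀ e, m ≤ (fourAvailable s e).card)
    {C : EvenCycle G} {L : List G.edgeSet} (hL : IsTraversal C L) (τ : State G P) :
    ∑' σ, (if C ∈ presentFlaws σ then transition L σ τ else 0) ≤
      ((m : ℝ≥0∞) ^ (C.1.card - 2))⁻¹ := by
  have hsupp : ∀ σ, (if C ∈ presentFlaws σ then transition L σ τ else 0) ≠ 0 →
      C ∈ presentFlaws σ ∧ τ ∈ actions L σ := by
    intro σ h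
    split_ifs at h with hC
    · exact ⟨hC, mem_actions_of_transition_ne_zero hm0 hm hL.nodup h⟩
    · exact absurd rfl h
  refine tsum_le_of_subsingleton_support (fun σ σ' h h' => ?_) fun σ => ?_
  · exact eq_of_mem_actions_of_mem_presentFlaws hL (hsupp σ h).1 (hsupp σ' h').1
      (hsupp σ h).2 (hsupp σ' h').2
  · by_cases h : (if C ∈ presentFlaws σ then transition L σ τ else 0) = 0
    · rw [h]
      exact zero_le
    · have hτ := (hsupp σ h).2
      rw [if_pos (hsupp σ h).1]
      obtain ⟨h', heq⟩ := transition_eq hm0 hm hL.nodup σ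
      rw [heq, PMF.uniformOfFinset_apply_of_mem h' hτ, ENNReal.inv_le_inv]
      have := pow_le_card_actions hm hL.nodup σ
      rw [hL.length_eq] at this
      exact_mod_cast this

lemma tsum_state_one_le : ∑' _ : State G P, (1 : ℝ≥0∞) ≤
    (2 : ℝ≥0∞) ^ (Nat.card G.edgeSet * Fintype.card P) := by
  classical
  let _ := Fintype.ofFinite (State G P)
  let _ := Fintype.ofFinite G.edgeSet
  have h1 : Fintype.card (State G P) ≤ 2 ^ (Nat.card G.edgeSet * Fintype.card P) :=
    calc Fintype.card (State G P) ≤ Fintype.card (G.edgeSet → P) :=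
          Fintype.card_le_of_injective (fun σ => σ.1) fun _ _ h => Subtype.ext h
      _ = Fintype.card P ^ Nat.card G.edgeSet := by
          rw [Fintype.card_fun, Nat.card_eq_fintype_card]
      _ ≤ (2 ^ Fintype.card P) ^ Nat.card G.edgeSet :=
          Nat.pow_le_pow_left Nat.lt_two_pow_self.le _
      _ = _ := by rw [← pow_mul, mul_comm]
  rw [tsum_fintype, Finset.sum_const, Finset.card_univ, nsmul_one]
  exact_mod_cast h1

/-- The rate at which the survival probability decays, for `2.182(Δ - 1)` available colors. The
weights are powers of `β / (Δ - 1)`, where `β = 0.57` is close to the minimizer of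
`(1 + β ^ 4 / (1 - β ^ 2)) ^ 3 / β ^ 2`; `1.1564` bounds `1 + β ^ 4 / (1 - β ^ 2)`. -/
noncomputable def decayRate : ℝ := 1.1564 ^ 6 / (2.182 * 0.57) ^ 4

lemma decayRate_pos : 0 < decayRate := by
  rw [decayRate]
  positivity

lemma decayRate_lt_one : decayRate < 1 := by
  rw [decayRate]
  norm_num

/-- The local lemma condition for a cycle of length `k + 2`. It is tightest for `k = 4`, which
gives `decayRate`. -/
lemma decayRate_bound {D M : ℝ} (hD : 0 < D) (hM : 2.182 * D ≤ M) {k : ℕ} (hk : 4 ≤ k) :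
    (M ^ k)⁻¹ * (1.1564 : ℝ) ^ (k + 2) ≤ decayRate * (0.57 / D) ^ k := by
  obtain ⟨j, rfl⟩ := Nat.exists_eq_add_of_le hk
  have hM0 : 0 < M := lt_of_lt_of_le (by positivity) hM
  have h1 : (1.1564 : ℝ) ^ (4 + j + 2) ≤ decayRate * (2.182 * 0.57) ^ (4 + j) := by
    calc (1.1564 : ℝ) ^ (4 + j + 2) = 1.1564 ^ 6 * 1.1564 ^ j := by ring
      _ ≤ 1.1564 ^ 6 * (2.182 * 0.57) ^ j := by
          gcongr
          norm_num
      _ = decayRate * (2.182 * 0.57) ^ (4 + j) := by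
          rw [decayRate, pow_add (2.182 * 0.57 : ℝ) 4 j, ← mul_assoc,
            div_mul_cancel₀ _ (by positivity)]
  rw [inv_mul_le_iff₀ (by positivity)]
  refine h1.trans ?_
  have h2 : (2.182 * 0.57 : ℝ) ≤ M * (0.57 / D) := by
    rw [← mul_div_assoc, le_div_iff₀ hD]
    linarith
  calc decayRate * (2.182 * 0.57) ^ (4 + j) ≤ decayRate * (M * (0.57 / D)) ^ (4 + j) :=
        mul_le_mul_of_nonneg_left (pow_le_pow_left₀ (by norm_num) h2 _) decayRate_pos.le
    _ = _ := by rw [mul_pow]; ring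

variable [DecidableRel G.Adj]

/-- The probability that the recursive walk on the colorings has a flaw left after `t` steps. -/
lemma recursiveWalk_presentFlaws_le (hΔ : 2 ≤ G.maxDegree)
    (hP : (4.182 : ℝ) * ((G.maxDegree : ℝ) - 1) ≤ Fintype.card P)
    {trav : EvenCycle G → List G.edgeSet} (htrav : ∀ C, IsTraversal C (trav C))
    {n : ℕ} (prio : EvenCycle G ≃ Fin n) (θ : PMF (State G P)) (t : ℕ) :
    (recursiveWalk prio presentFlaws cycleNbhd (fun C => transition (trav C)) θ t).toOuterMeasure
      {x | presentFlaws x.1 ≠ ∅} ≤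
      ENNReal.ofReal (2 ^ (Nat.card G.edgeSet * Fintype.card P + Nat.card G.edgeSet) *
        decayRate ^ t) := by
  classical
  let _ := Fintype.ofFinite (EvenCycle G)
  let _ := Fintype.ofFinite G.edgeSet
  set D : ℝ := (G.maxDegree : ℝ) - 1 with hDdef
  obtain ⟨m, hmdef⟩ : ∃ m : ℕ, m = Fintype.card P - 2 * (G.maxDegree - 1) := ⟨_, rfl⟩
  have hD : 0 < D := by
    have : (2 : ℝ) ≤ G.maxDegree := by exact_mod_cast hΔ
    rw [hDdef]
    linarith
  have hmD : 2.182 * D ≤ (m : ℝ) := by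
    have h1 : Fintype.card P ≤ m + 2 * (G.maxDegree - 1) := by omega
    have h2 : (Fintype.card P : ℝ) ≤ m + 2 * ((G.maxDegree - 1 : ℕ) : ℝ) := by exact_mod_cast h1
    rw [Nat.cast_sub (show 1 ≤ G.maxDegree by omega), Nat.cast_one, ← hDdef] at h2
    linarith
  have hm0 : 0 < m := by
    have : (0 : ℝ) < m := lt_of_lt_of_le (by positivity) hmD
    exact_mod_cast this
  have hm : ∀ s : G.edgeSet → Option P, IsGood s → ∀ e, m ≤ (fourAvailable s e).card :=
    fun s hs e => hmdef ▸ le_card_fourAvailable hs e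
  set ψ : EvenCycle G → ℝ≥0∞ := fun C => ENNReal.ofReal ((0.57 / D) ^ (C.1.card - 2)) with hψdef
  have hx : ∀ (e : G.edgeSet) (K : Finset (EvenCycle G)), (∀ C ∈ K, e ∈ C.1) →
      ∑ C ∈ K, ψ C ≤ ENNReal.ofReal 0.1564 := by
    intro e K hK
    rw [← ENNReal.ofReal_sum_of_nonneg fun C _ => by positivity]
    refine ENNReal.ofReal_le_ofReal 
      ((sum_weight_through_le hΔ (by norm_num) (by norm_num) e K hK).trans ?_)
    norm_num
  have hone : (1 : ℝ≥0∞) + ENNReal.ofReal 0.1564 = ENNReal.ofReal 1.1564 := by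
    rw [← ENNReal.ofReal_one, ← ENNReal.ofReal_add (by norm_num) (by norm_num)]
    norm_num
  have hindep : ∀ (A : Finset G.edgeSet) (B : Finset (EvenCycle G)),
      (∀ C ∈ B, ∃ e ∈ A, e ∈ C.1) →
      indepSum cycleNbhd ψ B ≤ ENNReal.ofReal (1.1564 ^ A.card) := by
    intro A B hB
    rw [ENNReal.ofReal_pow (by norm_num), ← hone]
    exact indepSum_le_one_add_pow (fun C : EvenCycle G => C.1)
      (fun _ _ => mem_cycleNbhd) hx A B hB
  have hne : ∀ C : EvenCycle G, ∃ e, e ∈ C.1 := fun C =>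
    Finset.card_pos.1 (by have := C.2.2.2; omega)
  refine (recursiveWalk_toOuterMeasure_le (prio := prio) (ψ := ψ)
    (γ := fun C => ((m : ℝ≥0∞) ^ (C.1.card - 2))⁻¹) (r := ENNReal.ofReal decayRate)
    ?_ ?_ ?_ ?_ ?_ θ t).trans ?_
  · intro a b h
    obtain ⟨e, h1, h2⟩ := mem_cycleNbhd.1 h
    exact mem_cycleNbhd.2 ⟨e, h2, h1⟩
  · intro a
    obtain ⟨e, he⟩ := hne a
    exact mem_cycleNbhd.2 ⟨e, he, he⟩
  · intro C σ τ _ h F hF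
    exact mem_presentFlaws_or_mem_cycleNbhd (htrav C)
      (mem_actions_of_transition_ne_zero hm0 hm (htrav C).nodup h) hF
  · intro C τ
    exact tsum_transition_le hm0 hm (htrav C) τ
  · intro C
    have h6 := C.2.2.2
    have h1 := hindep C.1 (cycleNbhd C) fun C' h => by
      obtain ⟨e, h1, h2⟩ := mem_cycleNbhd.1 h
      exact ⟨e, h1, h2⟩
    have hcast : ((m : ℝ≥0∞) ^ (C.1.card - 2))⁻¹ =
        ENNReal.ofReal (((m : ℝ) ^ (C.1.card - 2))⁻¹) := by
      rw [ENNReal.ofReal_inv_of_pos (by positivity), ENNReal.ofReal_pow (by positivity),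
        ENNReal.ofReal_natCast]
    refine (mul_le_mul_right h1 _).trans ?_
    simp only [hcast, hψdef]
    rw [← ENNReal.ofReal_mul (by positivity), ← ENNReal.ofReal_mul decayRate_pos.le]
    refine ENNReal.ofReal_le_ofReal ?_
    have := decayRate_bound hD hmD (k := C.1.card - 2) (by omega)
    rwa [show C.1.card - 2 + 2 = C.1.card by omega] at this
  · have h1 := hindep Finset.univ Finset.univ fun C _ => by
      obtain ⟨e, he⟩ := hne C
      exact ⟨e, Finset.mem_univ e, he⟩
    rw [Finset.card_univ, ← Nat.card_eq_fintype_card] at h1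
    have h2 : ENNReal.ofReal (1.1564 ^ Nat.card G.edgeSet) ≤ (2 : ℝ≥0∞) ^ Nat.card G.edgeSet := by
      rw [ENNReal.ofReal_pow (by norm_num)]
      gcongr
      rw [ENNReal.ofReal_le_ofNat]
      norm_num
    refine (mul_le_mul' (mul_le_mul' tsum_state_one_le le_rfl) (h1.trans h2)).trans_eq ?_
    rw [ENNReal.ofReal_mul (by positivity), ENNReal.ofReal_pow decayRate_pos.le,
      ENNReal.ofReal_pow (by norm_num), ENNReal.ofReal_ofNat, pow_add]
    ring

end Charges

end AEC

theorem mainTheorem5 :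
    ∃ (T₀ : MvPolynomial (Fin 3) ℕ) (δ : ℝ), 0 < δ ∧
      ∀ (V : Type*) [Fintype V] (G : SimpleGraph V) [DecidableRel G.Adj]
        (P : Type*) [Fintype P] [LinearOrder P],
        2 ≤ G.maxDegree →
        (4.182 : ℝ) * ((G.maxDegree : ℝ) - 1) ≤ (Fintype.card P : ℝ) →
        -- the ordering of the edges that determines the initial state
        ∀ (order : List G.edgeSet), order.Nodup → (∀ e, e ∈ order) →
        -- the choice of two adjacent edges in every even cycle of length at least 6
        ∀ (trav : AEC.EvenCycle G → List G.edgeSet), (∀ C, AEC.IsTraversal C (trav C)) →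
        -- the ordering of the flaws
        ∀ (n : ℕ) (prio : AEC.EvenCycle G ≃ Fin n),
        ∃ σ₁ : AEC.State G P,
          AEC.toPartial σ₁.1 = AEC.greedyColoring order ∧
          ∀ (s : ℝ) (t : ℕ),
            ((MvPolynomial.eval ![Nat.card G.edgeSet, G.maxDegree, Fintype.card P] T₀ : ℕ) + s) / δ
              ≤ (t : ℝ) →
            1 - (2 : ℝ) ^ (-s) ≤
              ((AEC.recursiveWalk prio AEC.presentFlaws AEC.cycleNbhd
                  (fun C => AEC.transition (trav C)) (PMF.pure σ₁) t).toOuterMeasure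
                {x | AEC.presentFlaws x.1 = ∅ ∧ AEC.IsAcyclicColoring x.1.1}).toReal := by
  have hδ : 0 < -Real.logb 2 AEC.decayRate :=
    neg_pos.2 (Real.logb_neg (by norm_num) AEC.decayRate_pos AEC.decayRate_lt_one)
  refine ⟨MvPolynomial.X 0 * MvPolynomial.X 2 + MvPolynomial.X 0, -Real.logb 2 AEC.decayRate, hδ,
    ?_⟩
  intro V _ G _ P _ _ hΔ hP order _ hall trav htrav n prio
  obtain ⟨σ₁, hσ₁⟩ := AEC.exists_state_greedyColoring (G := G) (P := P) (fun s hs e => by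
    refine Finset.card_pos.1 (lt_of_lt_of_le ?_ (AEC.le_card_fourAvailable hs e))
    have h2 : (2 : ℝ) ≤ G.maxDegree := by exact_mod_cast hΔ
    have h3 : (((2 * (G.maxDegree - 1) : ℕ)) : ℝ) < Fintype.card P := by
      rw [Nat.cast_mul, Nat.cast_sub (by omega)]
      push_cast
      linarith
    have h4 : 2 * (G.maxDegree - 1) < Fintype.card P := by exact_mod_cast h3
    omega) order hall
  refine ⟨σ₁, hσ₁, fun s t ht => ?_⟩
  have hbad := AEC.recursiveWalk_presentFlaws_le hΔ hP htrav prio (PMF.pure σ₁) t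
  set μ := AEC.recursiveWalk prio AEC.presentFlaws AEC.cycleNbhd
    (fun C => AEC.transition (trav C)) (PMF.pure σ₁) t
  set N : ℕ := Nat.card G.edgeSet * Fintype.card P + Nat.card G.edgeSet
  have hsmall : (2 : ℝ) ^ N * AEC.decayRate ^ t ≤ (2 : ℝ) ^ (-s) := by
    rw [div_le_iff₀ hδ] at ht
    simp only [map_add, map_mul, MvPolynomial.eval_X] at ht
    change ((N : ℕ) : ℝ) + s ≤ _ at ht
    have hrate : AEC.decayRate ^ t = (2 : ℝ) ^ (Real.logb 2 AEC.decayRate * t) := by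
      rw [Real.rpow_mul (by norm_num), Real.rpow_natCast,
        Real.rpow_logb (by norm_num) (by norm_num) AEC.decayRate_pos]
    rw [hrate, ← Real.rpow_natCast, ← Real.rpow_add (by norm_num)]
    refine Real.rpow_le_rpow_of_exponent_le (by norm_num) ?_
    linarith
  have hbad' : (μ.toOuterMeasure {x | AEC.presentFlaws x.1 ≠ ∅}).toReal ≤ (2 : ℝ) ^ (-s) :=
    (ENNReal.toReal_le_of_le_ofReal
      (mul_nonneg (by positivity) (pow_nonneg AEC.decayRate_pos.le t)) hbad).trans hsmall
  have hcover : (1 : ENNReal) ≤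
      μ.toOuterMeasure {x | AEC.presentFlaws x.1 = ∅ ∧ AEC.IsAcyclicColoring x.1.1} +
        μ.toOuterMeasure {x | AEC.presentFlaws x.1 ≠ ∅} := by
    rw [← (μ.toOuterMeasure_apply_eq_one_iff Set.univ).2 (Set.subset_univ _)]
    refine (MeasureTheory.measure_mono fun x _ => ?_).trans (MeasureTheory.measure_union_le _ _)
    by_cases hx : AEC.presentFlaws x.1 = ∅
    · exact Or.inl ⟨hx, AEC.isAcyclicColoring_of_presentFlaws_eq_empty hx⟩
    · exact Or.inr hx
  have hfin : ∀ A, μ.toOuterMeasure A ≠ ⊤ := fun A =>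
    ((MeasureTheory.measure_mono (Set.subset_univ A)).trans_lt (by
      rw [(μ.toOuterMeasure_apply_eq_one_iff Set.univ).2 (Set.subset_univ _)]
      exact ENNReal.one_lt_top)).ne
  have := ENNReal.toReal_mono (ENNReal.add_ne_top.2 ⟨hfin _, hfin _⟩) hcover
  rw [ENNReal.toReal_add (hfin _) (hfin _), ENNReal.toReal_one] at this
  linarith
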